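/- **Setting.** Let $(\mathcal V,\otimes,I)$ be a symmetric monoidal category with symmetry $\sigma$, let $A$ be a bimonoid in $\mathcal V$, with multiplication $\mu_A$, unit $\eta_A$, comultiplication $\delta_A$ and counit $\epsilon_A$, and let $\gamma:A\otimes A\to I$ be a braiding coelement, that is, a convolution-invertible morphism such that, in element notation, $$a_1b_1\,\gamma(b_2,a_2)=\gamma(b_1,a_1)\,b_2a_2,\qquad \gamma(a,bc)=\gamma(a_1,c)\,\gamma(a_2,b),\qquad \gamma(ab,c)=\gamma(a,c_1)\,\gamma(b,c_2).$$ For a bimonoid $A$ in a braided monoidal category, $\mathrm{Comod}(A)$ denotes the category of left $A$-comodules $(X,\ \alpha_X:X\to A\otimes X)$. It is monoidal: the coaction on $X\otimes Y$ is $(\mu_A\otimes 1\otimes 1)\circ(1\otimes\sigma_{X,A}\otimes 1)\circ(\alpha_X\otimes\alpha_Y)$, where $\sigma$ is the braiding, the unit object is $(I,\eta_A)$, and the associativity and unit constraints are those of the underlying category. The category $\mathcal W=\mathrm{Comod}_{\mathcal V}(A)$ is braided monoidal with braiding $$X\otimes Y\xrightarrow{\ \sigma\ }Y\otimes X\xrightarrow{\alpha_Y\otimes\alpha_X}A\otimes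 Y\otimes A\otimes X\xrightarrow{1\otimes\sigma\otimes1}A\otimes A\otimes Y\otimes X\xrightarrow{\gamma\otimes1\otimes1}Y\otimes X .$$ Let $H$ be a bimonoid in the braided monoidal category $\mathcal W$, with $A$-coaction $\alpha_H$. The semidirect product $H\rtimes A$ is the bimonoid in $\mathcal V$ with underlying object $H\otimes A$, unit $\eta_H\otimes\eta_A$, counit $\epsilon_H\otimes\epsilon_A$, comultiplication $(1_H\otimes\tau_H\otimes 1_A)\circ(\delta_H\otimes\delta_A)$, where $$\tau_H=\big(H\otimes A\xrightarrow{\alpha_H\otimes1}A\otimes H\otimes A\xrightarrow{1\otimes\sigma}A\otimes A\otimes H\xrightarrow{\mu_A\otimes1}A\otimes H\big),$$ and multiplication $(\mu_H\otimes\mu_A)\circ(1_H\otimes s_{A,H}\otimes1_A)$, where $s_{A,H}:A\otimes H\to H\otimes A$ is the braiding in $\mathcal W$ of $(A,\delta_A)$ with $H$. **Proposition.** The comparison functor $$F:\mathrm{Comod}_{\mathcal W}(H)\to\mathrm{Comod}_{\mathcal V}(H\rtimes A),\qquad ((B,\alpha_B),\chi_B)\mapsto\big(B,\ (1_H\otimes\alpha_B)\circ\chi_B\big),\qquad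 f\mapsto f,$$ is strict monoidal, and it is an isomorphism of categories whose inverse $$F^{-1}:\mathrm{Comod}_{\mathcal V}(H\rtimes A)\to\mathrm{Comod}_{\mathcal W}(H),\quad (B,\beta)\mapsto\Big(\big(B,\ \lambda_{A\otimes B}\circ(\epsilon_H\otimes1_A\otimes1_B)\circ\beta\big),\ (1_H\otimes\lambda_B)\circ(1_H\otimes\epsilon_A\otimes1_B)\circ\beta\Big),\quad f\mapsto f,$$ is strict monoidal as well. Here $\lambda$ denotes the left unit constraint of $\mathcal V$, associativity constraints are suppressed, and a functor is strict monoidal if it preserves the tensor product and the unit object on the nose, with identities as structure morphisms. -/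

import Mathlib

set_option linter.unusedSimpArgs false
set_option linter.unusedSectionVars false

universe v u

open CategoryTheory MonoidalCategory BraidedCategory
open scoped MonObj ComonObj

noncomputable section

/-- A (left) comodule for a comonoid `A` in a monoidal category. -/
@[ext]
structure Comod {C : Type u} [Category.{v} C] [MonoidalCategory C] (A : C) [ComonObj A] where
  X : C
  coact : X ⟶ A ⊗ X
  counit_coact : coact ≫ ε[A] ▷ X = (λ_ X).inv
  coact_coact : coact ≫ A ◁ coact = coact ≫ Δ[A] ▷ X ≫ (α_ A A X).hom

namespace Comod

section Basic

variable {C : Type u} [Category.{v} C] [MonoidalCategory C]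

/-- A morphism of comodules. -/
@[ext]
structure Hom {A : C} [ComonObj A] (M N : Comod A) where
  f : M.X ⟶ N.X
  comm : M.coact ≫ A ◁ f = f ≫ N.coact

variable {A : C} [ComonObj A]

instance : Category (Comod A) where
  Hom M N := Hom M N
  id M := ⟨𝟙 M.X, by simp⟩
  comp g h := ⟨g.f ≫ h.f, by
    rw [MonoidalCategory.whiskerLeft_comp, ← Category.assoc, g.comm, Category.assoc, h.comm,
      Category.assoc]⟩

@[ext] theorem hom_ext {M N : Comod A} {g h : M ⟶ N} (w : g.f = h.f) : g = h := Hom.ext w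

@[simp] theorem id_f (M : Comod A) : Hom.f (𝟙 M) = 𝟙 M.X := rfl

@[simp] theorem comp_f {M N P : Comod A} (g : M ⟶ N) (h : N ⟶ P) : (g ≫ h).f = g.f ≫ h.f := rfl

variable (A) in
/-- The forgetful functor. -/
@[simps]
def forget : Comod A ⥤ C where
  obj M := M.X
  map g := g.f

instance : (forget A).Faithful where
  map_injective h := hom_ext h

/-- An isomorphism of underlying objects compatible with the coactions. -/
@[simps]
def mkIso {M N : Comod A} (e : M.X ≅ N.X) (h : M.coact ≫ A ◁ e.hom = e.hom ≫ N.coact) : M ≅ N where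
  hom := ⟨e.hom, h⟩
  inv := ⟨e.inv, by
    rw [← cancel_epi e.hom, ← Category.assoc, ← h, Category.assoc, ← MonoidalCategory.whiskerLeft_comp]
    simp⟩

/-- Restriction of a comodule along a comonoid morphism. -/
def push {A B : C} [ComonObj A] [ComonObj B] (f : A ⟶ B) [IsComonHom f] (M : Comod A) :
    Comod B where
  X := M.X
  coact := M.coact ≫ f ▷ M.X
  counit_coact := by
    rw [Category.assoc, ← comp_whiskerRight, IsComonHom.hom_counit, M.counit_coact]
  coact_coact := by
    have h := M.coact_coact
    simp only [MonoidalCategory.whiskerLeft_comp, Category.assoc]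
    rw [← whisker_exchange_assoc, reassoc_of% h, ← comp_whiskerRight_assoc, IsComonHom.hom_comul]
    simp [MonoidalCategory.tensorHom_def]

end Basic

section Tensor

variable {C : Type u} [Category.{v} C] [MonoidalCategory C] [BraidedCategory C]

/-- The external tensor product of an `A`-comodule and a `B`-comodule, a comodule for `A ⊗ B`. -/
def box {A B : C} [ComonObj A] [ComonObj B] (M : Comod A) (N : Comod B) : Comod (A ⊗ B) where
  X := M.X ⊗ N.X
  coact := (M.coact ⊗ₘ N.coact) ≫ tensorμ A M.X B N.X
  counit_coact := by
    have h1 := M.counit_coact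
    have h2 := N.counit_coact
    rw [Comon.tensorObj_counit, comp_whiskerRight, Category.assoc, ← tensorHom_id,
      ← id_tensorHom_id, ← tensorμ_natural_assoc]
    simp only [tensorHom_id]
    rw [tensorHom_comp_tensorHom_assoc, h1, h2, ← cancel_mono (λ_ (M.X ⊗ N.X)).hom]
    simp only [Category.assoc]
    rw [← leftUnitor_monoidal, tensorHom_comp_tensorHom]
    simp
  coact_coact := by
    have h1 := M.coact_coact
    have h2 := N.coact_coact
    rw [Comon.tensorObj_comul, comp_whiskerRight]
    simp only [Category.assoc]
    rw [← tensorHom_id (Δ[A] ⊗ₘ Δ[B]), ← id_tensorHom_id, ← tensorμ_natural_assoc,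
      associator_monoidal]
    simp only [tensorHom_id, tensorHom_comp_tensorHom_assoc]
    rw [← h1, ← h2, ← tensorHom_comp_tensorHom_assoc]
    simp only [tensorμ_natural_assoc, ← id_tensorHom, id_tensorHom_id, tensorHom_comp_tensorHom,
      Category.comp_id]

variable {A : C} [BimonObj A]

instance : IsComonHom μ[A] where
  hom_counit := by
    rw [BimonObj.mul_counit]
  hom_comul := by
    rw [BimonObj.mul_comul]; simp

/-- The tensor product of comodules: the coaction is
`X ⊗ Y ⟶ (A ⊗ X) ⊗ (A ⊗ Y) ⟶ (A ⊗ A) ⊗ (X ⊗ Y) ⟶ A ⊗ (X ⊗ Y)`. -/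
def tensor (M N : Comod A) : Comod A where
  X := M.X ⊗ N.X
  coact := (M.coact ⊗ₘ N.coact) ≫ tensorμ A M.X A N.X ≫ μ[A] ▷ (M.X ⊗ N.X)
  counit_coact := by
    simpa [push, box] using (push μ[A] (box M N)).counit_coact
  coact_coact := by
    simpa [push, box] using (push μ[A] (box M N)).coact_coact

variable (A) in
/-- The unit comodule, with coaction the unit of `A`. -/
def unit : Comod A where
  X := 𝟙_ C
  coact := (λ_ (𝟙_ C)).inv ≫ η[A] ▷ 𝟙_ C
  counit_coact := by
    rw [Category.assoc, ← comp_whiskerRight, BimonObj.one_counit]; simp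
  coact_coact := by
    have := Bimon.one_comul A
    simp only [Category.assoc]
    rw [← comp_whiskerRight_assoc, this]
    simp only [MonoidalCategory.tensorHom_def]
    monoidal

/-- The tensor product of comodule morphisms. -/
def tensorHom {M N P Q : Comod A} (g : M ⟶ N) (h : P ⟶ Q) : tensor M P ⟶ tensor N Q where
  f := g.f ⊗ₘ h.f
  comm := by
    have h1 := g.comm
    have h2 := h.comm
    simp only [tensor, Category.assoc]
    rw [tensorHom_comp_tensorHom_assoc, ← h1, ← h2, ← whisker_exchange, ← tensorHom_comp_tensorHom_assoc,
      ← id_tensorHom A, ← id_tensorHom A, tensorμ_natural_assoc]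
    simp

def associator (M N P : Comod A) : tensor (tensor M N) P ≅ tensor M (tensor N P) :=
  mkIso (α_ M.X N.X P.X) (by
    have e1 : (((M.coact ⊗ₘ N.coact) ≫ tensorμ A M.X A N.X ≫ μ[A] ▷ (M.X ⊗ N.X)) ⊗ₘ P.coact) =
        ((M.coact ⊗ₘ N.coact) ⊗ₘ P.coact) ≫ tensorμ A M.X A N.X ▷ (A ⊗ P.X) ≫
          ((μ[A] ⊗ₘ 𝟙 (M.X ⊗ N.X)) ⊗ₘ (𝟙 A ⊗ₘ 𝟙 P.X)) := by
      simp only [← id_tensorHom, ← tensorHom_id, tensorHom_comp_tensorHom,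
        tensorHom_comp_tensorHom_assoc, Category.id_comp, Category.comp_id, id_tensorHom_id]
    have e2 : (M.coact ⊗ₘ ((N.coact ⊗ₘ P.coact) ≫ tensorμ A N.X A P.X ≫ μ[A] ▷ (N.X ⊗ P.X))) =
        (M.coact ⊗ₘ (N.coact ⊗ₘ P.coact)) ≫ (A ⊗ M.X) ◁ tensorμ A N.X A P.X ≫
          ((𝟙 A ⊗ₘ 𝟙 M.X) ⊗ₘ (μ[A] ⊗ₘ 𝟙 (N.X ⊗ P.X))) := by
      simp only [← id_tensorHom, ← tensorHom_id, tensorHom_comp_tensorHom,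
        tensorHom_comp_tensorHom_assoc, Category.id_comp, Category.comp_id, id_tensorHom_id]
    have e3 := tensor_associativity A M.X A N.X A P.X
    simp only [tensor, Category.assoc]
    rw [e1, e2]
    simp only [Category.assoc]
    rw [tensorμ_natural_assoc, tensorμ_natural_assoc, ← associator_naturality_assoc,
      ← reassoc_of% e3]
    have e4 := MonObj.mul_assoc A
    simp only [← id_tensorHom, ← tensorHom_id, tensorHom_comp_tensorHom,
        tensorHom_comp_tensorHom_assoc, Category.id_comp, Category.comp_id, id_tensorHom_id,
        Category.assoc] at e4 ⊢
    rw [e4])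

def leftUnitor (M : Comod A) : tensor (unit A) M ≅ M :=
  mkIso (λ_ M.X) (by
    have e1 : ((λ_ (𝟙_ C)).inv ≫ η[A] ▷ 𝟙_ C ⊗ₘ M.coact) =
        (λ_ (𝟙_ C)).inv ▷ M.X ≫ (𝟙_ C ⊗ 𝟙_ C) ◁ M.coact ≫
          ((η[A] ⊗ₘ 𝟙 (𝟙_ C)) ⊗ₘ (𝟙 A ⊗ₘ 𝟙 M.X)) := by
      simp only [← id_tensorHom, ← tensorHom_id, tensorHom_comp_tensorHom,
        tensorHom_comp_tensorHom_assoc, Category.id_comp, Category.comp_id, id_tensorHom_id]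
    have e3 := tensor_left_unitality A M.X
    simp only [tensor, unit]
    rw [e1]
    simp only [Category.assoc]
    rw [tensorμ_natural_assoc, ← whisker_exchange_assoc, ← leftUnitor_naturality, e3]
    have e4 := MonObj.one_mul A
    simp only [← id_tensorHom, ← tensorHom_id, tensorHom_comp_tensorHom,
        tensorHom_comp_tensorHom_assoc, Category.id_comp, Category.comp_id, id_tensorHom_id,
        Category.assoc] at e4 ⊢
    rw [e4])

def rightUnitor (M : Comod A) : tensor M (unit A) ≅ M :=
  mkIso (ρ_ M.X) (by
    have e1 : (M.coact ⊗ₘ (λ_ (𝟙_ C)).inv ≫ η[A] ▷ 𝟙_ C) =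
        M.X ◁ (λ_ (𝟙_ C)).inv ≫ M.coact ▷ (𝟙_ C ⊗ 𝟙_ C) ≫
          ((𝟙 A ⊗ₘ 𝟙 M.X) ⊗ₘ (η[A] ⊗ₘ 𝟙 (𝟙_ C))) := by
      simp only [← id_tensorHom, ← tensorHom_id, tensorHom_comp_tensorHom,
        tensorHom_comp_tensorHom_assoc, Category.id_comp, Category.comp_id, id_tensorHom_id]
    have e3 := tensor_right_unitality A M.X
    simp only [tensor, unit]
    rw [e1]
    simp only [Category.assoc]
    rw [tensorμ_natural_assoc, whisker_exchange_assoc, ← rightUnitor_naturality, e3]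
    have e4 := MonObj.mul_one A
    simp only [← id_tensorHom, ← tensorHom_id, tensorHom_comp_tensorHom,
        tensorHom_comp_tensorHom_assoc, Category.id_comp, Category.comp_id, id_tensorHom_id,
        Category.assoc] at e4 ⊢
    rw [e4])

instance : MonoidalCategoryStruct (Comod A) where
  tensorObj M N := tensor M N
  tensorUnit := unit A
  tensorHom g h := tensorHom g h
  whiskerLeft M N P g := ⟨M.X ◁ g.f, by simpa [tensorHom] using (tensorHom (𝟙 M) g).comm⟩
  whiskerRight g P := ⟨g.f ▷ P.X, by simpa [tensorHom] using (tensorHom g (𝟙 P)).comm⟩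
  associator M N P := associator M N P
  leftUnitor M := leftUnitor M
  rightUnitor M := rightUnitor M

instance : MonoidalCategory (Comod A) :=
  Monoidal.induced (forget A)
    { μIso := fun _ _ => Iso.refl _
      εIso := Iso.refl _
      whiskerLeft_eq := fun _ _ _ _ => ((Category.id_comp _).trans (Category.comp_id _)).symm
      whiskerRight_eq := fun _ _ => ((Category.id_comp _).trans (Category.comp_id _)).symm
      tensorHom_eq := fun _ _ => ((Category.id_comp _).trans (Category.comp_id _)).symm
      associator_eq := fun X Y Z => by
        change _ = (𝟙 ((X.X ⊗ Y.X) ⊗ Z.X) ≫ (𝟙 (X.X ⊗ Y.X) ⊗ₘ 𝟙 Z.X)) ≫ (α_ X.X Y.X Z.X).hom ≫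
          (𝟙 X.X ⊗ₘ 𝟙 (Y.X ⊗ Z.X)) ≫ 𝟙 _
        simp only [id_tensorHom_id, Category.id_comp, Category.comp_id]
        rfl
      leftUnitor_eq := fun X => by
        change _ = (𝟙 (𝟙_ C ⊗ X.X) ≫ (𝟙 (𝟙_ C) ⊗ₘ 𝟙 X.X)) ≫ (λ_ X.X).hom
        simp only [id_tensorHom_id, Category.id_comp, Category.comp_id]
        rfl
      rightUnitor_eq := fun X => by
        change _ = (𝟙 (X.X ⊗ 𝟙_ C) ≫ (𝟙 X.X ⊗ₘ 𝟙 (𝟙_ C))) ≫ (ρ_ X.X).hom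
        simp only [id_tensorHom_id, Category.id_comp, Category.comp_id]
        rfl }

@[simp] theorem tensorObj_X (M N : Comod A) : (M ⊗ N).X = M.X ⊗ N.X := rfl

theorem tensorObj_coact (M N : Comod A) : (M ⊗ N).coact =
    (M.coact ⊗ₘ N.coact) ≫ tensorμ A M.X A N.X ≫ μ[A] ▷ (M.X ⊗ N.X) := rfl

variable (A) in
@[simp] theorem tensorUnit_X : (𝟙_ (Comod A)).X = 𝟙_ C := rfl

variable (A) in
theorem tensorUnit_coact : (𝟙_ (Comod A)).coact = (λ_ (𝟙_ C)).inv ≫ η[A] ▷ 𝟙_ C := rfl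

@[simp] theorem tensorHom_f {M N P Q : Comod A} (g : M ⟶ N) (h : P ⟶ Q) :
    (g ⊗ₘ h).f = g.f ⊗ₘ h.f := rfl

@[simp] theorem whiskerLeft_f (M : Comod A) {P Q : Comod A} (h : P ⟶ Q) :
    (M ◁ h).f = M.X ◁ h.f := rfl

@[simp] theorem whiskerRight_f {M N : Comod A} (g : M ⟶ N) (P : Comod A) :
    (g ▷ P).f = g.f ▷ P.X := rfl

@[simp] theorem associator_hom_f (M N P : Comod A) : (α_ M N P).hom.f = (α_ M.X N.X P.X).hom := rfl
@[simp] theorem associator_inv_f (M N P : Comod A) : (α_ M N P).inv.f = (α_ M.X N.X P.X).inv := rfl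
@[simp] theorem leftUnitor_hom_f (M : Comod A) : (λ_ M).hom.f = (λ_ M.X).hom := rfl
@[simp] theorem leftUnitor_inv_f (M : Comod A) : (λ_ M).inv.f = (λ_ M.X).inv := rfl
@[simp] theorem rightUnitor_hom_f (M : Comod A) : (ρ_ M).hom.f = (ρ_ M.X).hom := rfl
@[simp] theorem rightUnitor_inv_f (M : Comod A) : (ρ_ M).inv.f = (ρ_ M.X).inv := rfl

end Tensor

end Comod

/-- A braiding coelement on a bimonoid `A` in a symmetric monoidal category: a convolution
invertible morphism `γ : A ⊗ A ⟶ 𝟙` such that, in element notation,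
`γ(b₁, a₁) b₂ a₂ = a₁ b₁ γ(b₂, a₂)`, `γ(a, b c) = γ(a₁, c) γ(a₂, b)` and
`γ(a b, c) = γ(a, c₁) γ(b, c₂)`. -/
class BraidingCoelement {C : Type u} [Category.{v} C] [MonoidalCategory C] [SymmetricCategory C]
    (A : C) [BimonObj A] where
  coelt : A ⊗ A ⟶ 𝟙_ C
  coeltInv : A ⊗ A ⟶ 𝟙_ C
  coelt_coeltInv : Δ[A ⊗ A] ≫ (coelt ⊗ₘ coeltInv) ≫ (λ_ (𝟙_ C)).hom = ε[A ⊗ A]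
  coeltInv_coelt : Δ[A ⊗ A] ≫ (coeltInv ⊗ₘ coelt) ≫ (λ_ (𝟙_ C)).hom = ε[A ⊗ A]
  coelt_comm : Δ[A ⊗ A] ≫ (coelt ⊗ₘ μ[A]) ≫ (λ_ A).hom =
    Δ[A ⊗ A] ≫ (((β_ A A).hom ≫ μ[A]) ⊗ₘ coelt) ≫ (ρ_ A).hom
  coelt_mul_right : A ◁ μ[A] ≫ coelt =
    Δ[A] ▷ (A ⊗ A) ≫ (A ⊗ A) ◁ (β_ A A).hom ≫ tensorμ A A A A ≫ (coelt ⊗ₘ coelt) ≫ (λ_ (𝟙_ C)).hom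
  coelt_mul_left : μ[A] ▷ A ≫ coelt =
    (A ⊗ A) ◁ Δ[A] ≫ tensorμ A A A A ≫ (coelt ⊗ₘ coelt) ≫ (λ_ (𝟙_ C)).hom

namespace Comod

section Act

variable {C : Type u} [Category.{v} C] [MonoidalCategory C]

/-- The endomorphism `x ↦ φ(x_K) x` given by a coaction of `K` and a morphism `φ : K ⟶ 𝟙`. -/
def act {K X : C} (φ : K ⟶ 𝟙_ C) (c : X ⟶ K ⊗ X) : X ⟶ X := c ≫ φ ▷ X ≫ (λ_ X).hom

variable {K : C} [ComonObj K]

theorem act_coact {X : C} (φ : K ⟶ 𝟙_ C) (c : X ⟶ K ⊗ X)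
    (h : c ≫ K ◁ c = c ≫ Δ[K] ▷ X ≫ (α_ K K X).hom) :
    act φ c ≫ c = c ≫ (Δ[K] ≫ φ ▷ K ≫ (λ_ K).hom) ▷ X := by
  simp only [act, Category.assoc]
  rw [← leftUnitor_naturality, ← whisker_exchange_assoc, reassoc_of% h]
  simp

theorem coact_act {X : C} (φ : K ⟶ 𝟙_ C) (c : X ⟶ K ⊗ X)
    (h : c ≫ K ◁ c = c ≫ Δ[K] ▷ X ≫ (α_ K K X).hom) :
    c ≫ K ◁ act φ c = c ≫ (Δ[K] ≫ K ◁ φ ≫ (ρ_ K).hom) ▷ X := by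
  simp only [act, MonoidalCategory.whiskerLeft_comp]
  rw [reassoc_of% h]
  simp

theorem act_comp {X : C} (φ ψ : K ⟶ 𝟙_ C) (c : X ⟶ K ⊗ X)
    (h : c ≫ K ◁ c = c ≫ Δ[K] ▷ X ≫ (α_ K K X).hom) :
    act φ c ≫ act ψ c = act (Δ[K] ≫ (φ ⊗ₘ ψ) ≫ (λ_ (𝟙_ C)).hom) c := by
  have h' := act_coact φ c h
  have e : act ψ c = c ≫ ψ ▷ X ≫ (λ_ X).hom := rfl
  rw [e, reassoc_of% h', act]
  simp [MonoidalCategory.tensorHom_def]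

theorem act_counit {X : C} (c : X ⟶ K ⊗ X) (h : c ≫ ε[K] ▷ X = (λ_ X).inv) :
    act ε[K] c = 𝟙 X := by
  rw [act, reassoc_of% h]; simp

end Act

section Box

variable {C : Type u} [Category.{v} C] [MonoidalCategory C] [SymmetricCategory C]
variable {A B D X Y Z : C}

/-- The coaction `X ⊗ Y ⟶ (A ⊗ B) ⊗ (X ⊗ Y)`. -/
def boxCoact (c : X ⟶ A ⊗ X) (d : Y ⟶ B ⊗ Y) : X ⊗ Y ⟶ (A ⊗ B) ⊗ (X ⊗ Y) :=
  (c ⊗ₘ d) ≫ tensorμ A X B Y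

theorem box_swap (c : X ⟶ A ⊗ X) (d : Y ⟶ B ⊗ Y) :
    boxCoact c d ≫ (A ⊗ B) ◁ (β_ X Y).hom =
      (β_ X Y).hom ≫ boxCoact d c ≫ (β_ B A).hom ▷ (Y ⊗ X) := by
  have h : tensorμ A X B Y ≫ (A ⊗ B) ◁ (β_ X Y).hom =
      (β_ (A ⊗ X) (B ⊗ Y)).hom ≫ tensorμ B Y A X ≫ (β_ B A).hom ▷ (Y ⊗ X) := by
    simp [tensorμ, SymmetricCategory.braiding_swap_eq_inv_braiding Y A,
      SymmetricCategory.braiding_swap_eq_inv_braiding B A, MonoidalCategory.tensorHom_def]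
    calc _ = 𝟙 _ ⊗≫ A ◁ (β_ X B).hom ▷ Y ⊗≫ (A ⊗ B) ◁ (β_ X Y).hom := by monoidal
      _ = 𝟙 _ ⊗≫ A ◁ (β_ X B).hom ▷ Y ⊗≫ (β_ B A).inv ▷ (X ⊗ Y) ≫ ((B ⊗ A) ◁ (β_ X Y).hom ≫
          (β_ B A).hom ▷ (Y ⊗ X)) := by
        rw [whisker_exchange, ← comp_whiskerRight_assoc, Iso.inv_hom_id]; monoidal
      _ = _ := by monoidal
  simp only [boxCoact, Category.assoc]
  rw [h, braiding_naturality_assoc]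

theorem act_box_swap (c : X ⟶ A ⊗ X) (d : Y ⟶ B ⊗ Y) (φ : A ⊗ B ⟶ 𝟙_ C) :
    act φ (boxCoact c d) ≫ (β_ X Y).hom =
      (β_ X Y).hom ≫ act ((β_ B A).hom ≫ φ) (boxCoact d c) := by
  have h := box_swap c d
  simp only [act, Category.assoc]
  simp only [comp_whiskerRight, Category.assoc]
  rw [← reassoc_of% h, whisker_exchange_assoc, leftUnitor_naturality]

theorem act_box_assoc (c : X ⟶ A ⊗ X) (d : Y ⟶ B ⊗ Y) (e : Z ⟶ D ⊗ Z)
    (φ : (A ⊗ B) ⊗ D ⟶ 𝟙_ C) :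
    act φ (boxCoact (boxCoact c d) e) ≫ (α_ X Y Z).hom =
      (α_ X Y Z).hom ≫ act ((α_ A B D).inv ≫ φ) (boxCoact c (boxCoact d e)) := by
  have h := tensor_associativity A X B Y D Z
  have e1 : (((c ⊗ₘ d) ≫ tensorμ A X B Y) ⊗ₘ e) =
      ((c ⊗ₘ d) ⊗ₘ e) ≫ tensorμ A X B Y ▷ (D ⊗ Z) := by
    simp only [← id_tensorHom, ← tensorHom_id, tensorHom_comp_tensorHom,
    tensorHom_comp_tensorHom_assoc, Category.id_comp, Category.comp_id, id_tensorHom_id, Category.assoc]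
  have e2 : (c ⊗ₘ ((d ⊗ₘ e) ≫ tensorμ B Y D Z)) =
      (c ⊗ₘ (d ⊗ₘ e)) ≫ (A ⊗ X) ◁ tensorμ B Y D Z := by
    simp only [← id_tensorHom, ← tensorHom_id, tensorHom_comp_tensorHom,
    tensorHom_comp_tensorHom_assoc, Category.id_comp, Category.comp_id, id_tensorHom_id, Category.assoc]
  simp only [act, boxCoact, Category.assoc]
  rw [e1, e2]
  simp only [Category.assoc]
  rw [← associator_naturality_assoc, ← reassoc_of% h]
  have e3 : ((α_ A B D).hom ⊗ₘ (α_ X Y Z).hom) ≫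
      ((α_ A B D).inv ≫ φ) ▷ (X ⊗ Y ⊗ Z) ≫ (λ_ (X ⊗ Y ⊗ Z)).hom =
      φ ▷ _ ≫ (λ_ _).hom ≫ (α_ X Y Z).hom := by
    rw [← leftUnitor_naturality, MonoidalCategory.tensorHom_def', Category.assoc,
      ← comp_whiskerRight_assoc, Iso.hom_inv_id_assoc, whisker_exchange_assoc]
  rw [e3]

theorem act_box_tensor (c : X ⟶ A ⊗ X) (d : Y ⟶ B ⊗ Y) (φ : A ⟶ 𝟙_ C) (ψ : B ⟶ 𝟙_ C) :
    act ((φ ⊗ₘ ψ) ≫ (λ_ (𝟙_ C)).hom) (boxCoact c d) = act φ c ⊗ₘ act ψ d := by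
  simp only [act, boxCoact, Category.assoc]
  rw [comp_whiskerRight, Category.assoc, ← tensorHom_id (φ ⊗ₘ ψ), ← id_tensorHom_id,
    ← tensorμ_natural_assoc, ← leftUnitor_monoidal]
  simp only [← id_tensorHom, ← tensorHom_id, tensorHom_comp_tensorHom,
    tensorHom_comp_tensorHom_assoc, Category.id_comp, Category.comp_id, id_tensorHom_id, Category.assoc]

theorem act_box_left {A' : C} (f : A ⟶ A') (c : X ⟶ A ⊗ X) (d : Y ⟶ B ⊗ Y)
    (φ : A' ⊗ B ⟶ 𝟙_ C) :
    act φ (boxCoact (c ≫ f ▷ X) d) = act (f ▷ B ≫ φ) (boxCoact c d) := by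
  simp only [act, boxCoact, Category.assoc]
  rw [comp_whiskerRight, Category.assoc, ← tensorHom_id f B, ← tensorHom_id (f ⊗ₘ 𝟙 B),
    ← id_tensorHom_id X Y, ← tensorμ_natural_assoc]
  simp only [← id_tensorHom, ← tensorHom_id, tensorHom_comp_tensorHom,
    tensorHom_comp_tensorHom_assoc, Category.id_comp, Category.comp_id, id_tensorHom_id, Category.assoc]

theorem act_box_right {B' : C} (f : B ⟶ B') (c : X ⟶ A ⊗ X) (d : Y ⟶ B ⊗ Y)
    (φ : A ⊗ B' ⟶ 𝟙_ C) :
    act φ (boxCoact c (d ≫ f ▷ Y)) = act (A ◁ f ≫ φ) (boxCoact c d) := by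
  simp only [act, boxCoact, Category.assoc]
  rw [comp_whiskerRight, Category.assoc, ← id_tensorHom A f, ← tensorHom_id (𝟙 A ⊗ₘ f),
    ← id_tensorHom_id X Y, ← tensorμ_natural_assoc]
  simp only [← id_tensorHom, ← tensorHom_id, tensorHom_comp_tensorHom,
    tensorHom_comp_tensorHom_assoc, Category.id_comp, Category.comp_id, id_tensorHom_id, Category.assoc]

theorem act_box_nat_right {Y' : C} (c : X ⟶ A ⊗ X) (d : Y ⟶ B ⊗ Y) (d' : Y' ⟶ B ⊗ Y')
    (g : Y ⟶ Y') (h : d ≫ B ◁ g = g ≫ d') (φ : A ⊗ B ⟶ 𝟙_ C) :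
    act φ (boxCoact c d) ≫ X ◁ g = X ◁ g ≫ act φ (boxCoact c d') := by
  have e : X ◁ g ≫ (c ⊗ₘ d') = (c ⊗ₘ d) ≫ ((𝟙 A ⊗ₘ 𝟙 X) ⊗ₘ (𝟙 B ⊗ₘ g)) := by
    simp only [← id_tensorHom, ← tensorHom_id, tensorHom_comp_tensorHom,
      Category.id_comp, Category.comp_id, id_tensorHom_id]
    rw [← h, id_tensorHom]
  simp only [act, boxCoact, Category.assoc]
  rw [reassoc_of% e, tensorμ_natural_assoc, ← leftUnitor_naturality, ← whisker_exchange_assoc]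
  simp

theorem act_box_nat_left {X' : C} (c : X ⟶ A ⊗ X) (c' : X' ⟶ A ⊗ X') (d : Y ⟶ B ⊗ Y)
    (g : X ⟶ X') (h : c ≫ A ◁ g = g ≫ c') (φ : A ⊗ B ⟶ 𝟙_ C) :
    act φ (boxCoact c d) ≫ g ▷ Y = g ▷ Y ≫ act φ (boxCoact c' d) := by
  have e : g ▷ Y ≫ (c' ⊗ₘ d) = (c ⊗ₘ d) ≫ ((𝟙 A ⊗ₘ g) ⊗ₘ (𝟙 B ⊗ₘ 𝟙 Y)) := by
    simp only [← id_tensorHom, ← tensorHom_id, tensorHom_comp_tensorHom,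
      Category.id_comp, Category.comp_id, id_tensorHom_id]
    rw [← h, id_tensorHom]
  simp only [act, boxCoact, Category.assoc]
  rw [reassoc_of% e, tensorμ_natural_assoc, ← leftUnitor_naturality, ← whisker_exchange_assoc]
  simp

variable (X Y Z) in
theorem coh_left (W : C) :
    ((ρ_ X).inv ⊗ₘ ((α_ Y Z W).inv ≫ (β_ Y Z).hom ▷ W ≫ (α_ Z Y W).hom)) ≫
      tensorμ X (𝟙_ C) Z (Y ⊗ W) ≫ (X ⊗ Z) ◁ (λ_ (Y ⊗ W)).hom =
    (α_ X Y (Z ⊗ W)).inv ≫ tensorμ X Y Z W := by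
  simp only [tensorμ, MonoidalCategory.tensorHom_def, braiding_tensorUnit_left]
  monoidal

variable (X Y Z) in
theorem coh_right (W : C) :
    (α_ X Y Z).hom ▷ W ≫ (X ⊗ (Y ⊗ Z)) ◁ (ρ_ W).inv ≫
      tensorμ X (Y ⊗ Z) W (𝟙_ C) ≫ (X ⊗ W) ◁ (ρ_ (Y ⊗ Z)).hom =
    (α_ (X ⊗ Y) Z W).hom ≫ (X ⊗ Y) ◁ (β_ Z W).hom ≫ tensorμ X Y W Z := by
  simp [tensorμ, MonoidalCategory.tensorHom_def]

theorem boxCoact_counit [ComonObj A] [ComonObj B] (M : Comod A) (N : Comod B) :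
    boxCoact M.coact N.coact ≫ ε[A ⊗ B] ▷ (M.X ⊗ N.X) = (λ_ (M.X ⊗ N.X)).inv :=
  (box M N).counit_coact

theorem boxCoact_coassoc [ComonObj A] [ComonObj B] (M : Comod A) (N : Comod B) :
    boxCoact M.coact N.coact ≫ (A ⊗ B) ◁ boxCoact M.coact N.coact =
      boxCoact M.coact N.coact ≫ Δ[A ⊗ B] ▷ (M.X ⊗ N.X) ≫
        (α_ (A ⊗ B) (A ⊗ B) (M.X ⊗ N.X)).hom :=
  (box M N).coact_coact

end Box

section Braided

variable {C : Type u} [Category.{v} C] [MonoidalCategory C] [SymmetricCategory C]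
variable {A : C} [BimonObj A]

theorem tensorObj_coact' (M N : Comod A) :
    (M ⊗ N).coact = boxCoact M.coact N.coact ≫ μ[A] ▷ (M.X ⊗ N.X) := by
  simp [boxCoact, tensorObj_coact]

variable [BraidingCoelement A]

open BraidingCoelement (coelt coeltInv coelt_coeltInv coeltInv_coelt coelt_comm
  coelt_mul_right coelt_mul_left)

/-- The underlying isomorphism of the braiding:
`X ⊗ Y ⟶ Y ⊗ X ⟶ (A ⊗ Y) ⊗ (A ⊗ X) ⟶ (A ⊗ A) ⊗ (Y ⊗ X) ⟶ Y ⊗ X`. -/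
def braidIso (M N : Comod A) : M.X ⊗ N.X ≅ N.X ⊗ M.X where
  hom := (β_ M.X N.X).hom ≫ (N.coact ⊗ₘ M.coact) ≫ tensorμ A N.X A M.X ≫
    coelt ▷ (N.X ⊗ M.X) ≫ (λ_ (N.X ⊗ M.X)).hom
  inv := ((N.coact ⊗ₘ M.coact) ≫ tensorμ A N.X A M.X ≫
    coeltInv ▷ (N.X ⊗ M.X) ≫ (λ_ (N.X ⊗ M.X)).hom) ≫ (β_ M.X N.X).inv
  hom_inv_id := by
    have h := act_comp coelt coeltInv _ (boxCoact_coassoc N M)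
    rw [coelt_coeltInv, act_counit _ (boxCoact_counit N M)] at h
    simp only [act, boxCoact, Category.assoc] at h
    simp only [Category.assoc]
    rw [reassoc_of% h]; simp
  inv_hom_id := by
    have h := act_comp coeltInv coelt _ (boxCoact_coassoc N M)
    rw [coeltInv_coelt, act_counit _ (boxCoact_counit N M)] at h
    simp only [act, boxCoact, Category.assoc] at h
    simp only [Category.assoc, Iso.inv_hom_id_assoc]
    exact h

theorem braidIso_hom (M N : Comod A) :
    (braidIso M N).hom = (β_ M.X N.X).hom ≫ act coelt (boxCoact N.coact M.coact) := by
  simp [braidIso, act, boxCoact]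

/-- The braiding of comodules. -/
def braiding (M N : Comod A) : M ⊗ N ≅ N ⊗ M :=
  mkIso (braidIso M N) (by
    have h1 := box_swap M.coact N.coact
    have h2 := coact_act coelt _ (boxCoact_coassoc N M)
    have h3 := act_coact coelt _ (boxCoact_coassoc N M)
    have h4 : (Δ[A ⊗ A] ≫ (A ⊗ A) ◁ coelt ≫ (ρ_ (A ⊗ A)).hom) ≫ (β_ A A).hom ≫ μ[A] =
        (Δ[A ⊗ A] ≫ coelt ▷ (A ⊗ A) ≫ (λ_ (A ⊗ A)).hom) ≫ μ[A] := by
      have h := coelt_comm (A := A)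
      rw [MonoidalCategory.tensorHom_def, MonoidalCategory.tensorHom_def'] at h
      simp only [Category.assoc, leftUnitor_naturality, rightUnitor_naturality] at h
      simp only [Category.assoc, h]
    rw [braidIso_hom, tensorObj_coact', tensorObj_coact']
    simp only [tensorObj_X, Category.assoc, MonoidalCategory.whiskerLeft_comp]
    rw [reassoc_of% h3, ← whisker_exchange_assoc, ← whisker_exchange, reassoc_of% h1,
      ← whisker_exchange_assoc, reassoc_of% h2, ← comp_whiskerRight, ← comp_whiskerRight,
      ← comp_whiskerRight, h4])

theorem braiding_natural {M N P Q : Comod A} (g : M ⟶ N) (h : P ⟶ Q) :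
    (g.f ⊗ₘ h.f) ≫ (braidIso N Q).hom = (braidIso M P).hom ≫ (h.f ⊗ₘ g.f) := by
  have h1 := g.comm
  have h2 := h.comm
  simp only [braidIso, Category.assoc]
  rw [braiding_naturality_assoc, tensorHom_comp_tensorHom_assoc, ← h1, ← h2,
    ← tensorHom_comp_tensorHom_assoc, ← id_tensorHom A, ← id_tensorHom A, tensorμ_natural_assoc,
    id_tensorHom_id, id_tensorHom, whisker_exchange_assoc, leftUnitor_naturality]

theorem conv_left : Δ[A ⊗ (A ⊗ A)] ≫ ((A ◁ (ε[A] ▷ A ≫ (λ_ A).hom) ≫ coelt) ⊗ₘ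
      (ε[A] ▷ (A ⊗ A) ≫ (λ_ (A ⊗ A)).hom ≫ coelt)) ≫ (λ_ (𝟙_ C)).hom =
    (α_ A A A).inv ≫ μ[A] ▷ A ≫ coelt := by
  rw [coelt_mul_left, Comon.tensorObj_comul]
  have e1 : ((A ◁ (ε[A] ▷ A ≫ (λ_ A).hom) ≫ coelt) ⊗ₘ (ε[A] ▷ (A ⊗ A) ≫ (λ_ (A ⊗ A)).hom ≫ coelt))
    = ((𝟙 A ⊗ₘ (ε[A] ▷ A ≫ (λ_ A).hom)) ⊗ₘ (ε[A] ⊗ₘ 𝟙 (A ⊗ A))) ≫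
      (coelt ⊗ₘ ((λ_ (A ⊗ A)).hom ≫ coelt)) := by
    simp only [tensorHom_comp_tensorHom, id_tensorHom, tensorHom_id, Category.assoc]
  have e2 : Δ[A] ≫ (𝟙 A ⊗ₘ ε[A]) = (ρ_ A).inv := by simp
  have e3 : Δ[A ⊗ A] ≫ ((ε[A] ▷ A ≫ (λ_ A).hom) ⊗ₘ 𝟙 (A ⊗ A)) =
      A ◁ Δ[A] ≫ (α_ A A A).inv ≫ (β_ A A).hom ▷ A ≫ (α_ A A A).hom := by
    have : ((ε[A] ▷ A ≫ (λ_ A).hom) ⊗ₘ 𝟙 (A ⊗ A)) =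
      ((ε[A] ⊗ₘ 𝟙 A) ⊗ₘ (𝟙 A ⊗ₘ 𝟙 A)) ≫ (λ_ A).hom ▷ (A ⊗ A) := by
      simp only [tensorHom_id, id_whiskerRight, ← comp_whiskerRight]
    rw [this, Comon.tensorObj_comul, Category.assoc, ← tensorμ_natural_assoc,
      tensorHom_comp_tensorHom_assoc]
    simp [tensorμ, MonoidalCategory.tensorHom_def]
  have e4 : ((ρ_ A).inv ⊗ₘ (A ◁ Δ[A] ≫ (α_ A A A).inv ≫ (β_ A A).hom ▷ A ≫ (α_ A A A).hom)) =
      A ◁ A ◁ Δ[A] ≫ ((ρ_ A).inv ⊗ₘ ((α_ A A A).inv ≫ (β_ A A).hom ▷ A ≫ (α_ A A A).hom)) := by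
    rw [← id_tensorHom A (A ◁ Δ[A]), tensorHom_comp_tensorHom, Category.id_comp]
  have e5 : (coelt (A := A) ⊗ₘ ((λ_ (A ⊗ A)).hom ≫ coelt)) =
      (A ⊗ A) ◁ (λ_ (A ⊗ A)).hom ≫ (coelt ⊗ₘ coelt) := by
    rw [← id_tensorHom, tensorHom_comp_tensorHom, Category.id_comp]
  have h := coh_left A A A A
  rw [e1]
  simp only [Category.assoc]
  rw [← tensorμ_natural_assoc, tensorHom_comp_tensorHom_assoc, e2, e3, e4, e5]
  simp only [Category.assoc]
  rw [reassoc_of% h]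
  simp

theorem conv_right : Δ[(A ⊗ A) ⊗ A] ≫ (((A ◁ ε[A] ≫ (ρ_ A).hom) ▷ A ≫ coelt) ⊗ₘ
      ((A ⊗ A) ◁ ε[A] ≫ (ρ_ (A ⊗ A)).hom ≫ coelt)) ≫ (λ_ (𝟙_ C)).hom =
    (α_ A A A).hom ≫ A ◁ μ[A] ≫ coelt := by
  rw [coelt_mul_right, Comon.tensorObj_comul]
  have e1 : (((A ◁ ε[A] ≫ (ρ_ A).hom) ▷ A ≫ coelt) ⊗ₘ
      ((A ⊗ A) ◁ ε[A] ≫ (ρ_ (A ⊗ A)).hom ≫ coelt)) =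
      (((A ◁ ε[A] ≫ (ρ_ A).hom) ⊗ₘ 𝟙 A) ⊗ₘ (𝟙 (A ⊗ A) ⊗ₘ ε[A])) ≫
      (coelt ⊗ₘ ((ρ_ (A ⊗ A)).hom ≫ coelt)) := by
    simp only [tensorHom_comp_tensorHom, id_tensorHom, tensorHom_id, Category.assoc]
  have e2 : Δ[A] ≫ (𝟙 A ⊗ₘ ε[A]) = (ρ_ A).inv := by simp
  have e3 : Δ[A ⊗ A] ≫ ((A ◁ ε[A] ≫ (ρ_ A).hom) ⊗ₘ 𝟙 (A ⊗ A)) =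
      Δ[A] ▷ A ≫ (α_ A A A).hom := by
    have : ((A ◁ ε[A] ≫ (ρ_ A).hom) ⊗ₘ 𝟙 (A ⊗ A)) =
      ((𝟙 A ⊗ₘ ε[A]) ⊗ₘ (𝟙 A ⊗ₘ 𝟙 A)) ≫ (ρ_ A).hom ▷ (A ⊗ A) := by
      simp only [tensorHom_id, id_tensorHom, id_whiskerRight, ← comp_whiskerRight]
    rw [this, Comon.tensorObj_comul, Category.assoc, ← tensorμ_natural_assoc,
      tensorHom_comp_tensorHom_assoc]
    simp [tensorμ, MonoidalCategory.tensorHom_def]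
    monoidal
  have e4 : ((Δ[A] ▷ A ≫ (α_ A A A).hom) ⊗ₘ (ρ_ A).inv) =
      Δ[A] ▷ A ▷ A ≫ (α_ A A A).hom ▷ A ≫ (A ⊗ (A ⊗ A)) ◁ (ρ_ A).inv := by
    simp [MonoidalCategory.tensorHom_def]
  have e5 : (coelt (A := A) ⊗ₘ ((ρ_ (A ⊗ A)).hom ≫ coelt)) =
      (A ⊗ A) ◁ (ρ_ (A ⊗ A)).hom ≫ (coelt ⊗ₘ coelt) := by
    rw [← id_tensorHom, tensorHom_comp_tensorHom, Category.id_comp]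
  have h := coh_right A A A A
  rw [e1]
  simp only [Category.assoc]
  rw [← tensorμ_natural_assoc, tensorHom_comp_tensorHom_assoc, e2, e3, e4, e5]
  simp only [Category.assoc]
  rw [reassoc_of% h]
  simp

theorem hexagon_fwd (X Y Z : Comod A) :
    (α_ X.X Y.X Z.X).hom ≫ (braidIso X (Y ⊗ Z)).hom ≫ (α_ Y.X Z.X X.X).hom =
      (braidIso X Y).hom ▷ Z.X ≫ (α_ Y.X X.X Z.X).hom ≫ Y.X ◁ (braidIso X Z).hom := by
  have h1 := act_box_left μ[A] (boxCoact Y.coact Z.coact) X.coact coelt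
  have h2 := act_box_assoc Y.coact Z.coact X.coact (μ[A] ▷ A ≫ coelt)
  have h3 := act_box_tensor (boxCoact Y.coact X.coact) Z.coact coelt ε[A]
  have h4 := act_box_tensor Y.coact (boxCoact Z.coact X.coact) ε[A] coelt
  have h5 := act_box_assoc Y.coact X.coact Z.coact ((coelt ⊗ₘ ε[A]) ≫ (λ_ (𝟙_ C)).hom)
  rw [act_counit _ Z.counit_coact, tensorHom_id] at h3
  rw [act_counit _ Y.counit_coact, id_tensorHom] at h4
  rw [braidIso_hom, braidIso_hom, braidIso_hom, tensorObj_coact']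
  simp only [tensorObj_X, Category.assoc, comp_whiskerRight, MonoidalCategory.whiskerLeft_comp]
  have h7 := act_box_nat_right Y.coact (boxCoact X.coact Z.coact)
    (boxCoact Z.coact X.coact ≫ (β_ A A).hom ▷ (Z.X ⊗ X.X)) (β_ X.X Z.X).hom (box_swap _ _)
    ((α_ A A A).inv ≫ (coelt ⊗ₘ ε[A]) ≫ (λ_ (𝟙_ C)).hom)
  rw [act_box_right] at h7
  have h8 := act_comp (A ◁ (β_ A A).hom ≫ (α_ A A A).inv ≫ (coelt ⊗ₘ ε[A]) ≫ (λ_ (𝟙_ C)).hom)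
    ((ε[A] ⊗ₘ coelt) ≫ (λ_ (𝟙_ C)).hom) _ (boxCoact_coassoc Y (box Z X))
  have h9 : A ◁ (β_ A A).hom ≫ (α_ A A A).inv ≫ (coelt ⊗ₘ ε[A]) ≫ (λ_ (𝟙_ C)).hom =
      A ◁ (ε[A] ▷ A ≫ (λ_ A).hom) ≫ coelt := by
    rw [MonoidalCategory.tensorHom_def', Category.assoc, unitors_equal, rightUnitor_naturality]
    have e : (β_ A A).hom ≫ A ◁ ε[A] ≫ (ρ_ A).hom = ε[A] ▷ A ≫ (λ_ A).hom := by
      rw [← braiding_naturality_left_assoc]; simp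
    rw [← e]
    simp
  have h10 : (ε[A] ⊗ₘ coelt) ≫ (λ_ (𝟙_ C)).hom =
      ε[A] ▷ (A ⊗ A) ≫ (λ_ (A ⊗ A)).hom ≫ coelt := by
    simp [MonoidalCategory.tensorHom_def]
  rw [h9, h10, conv_left, ← h10] at h8
  rw [h9] at h7
  change act _ (boxCoact Y.coact (boxCoact Z.coact X.coact)) ≫
    act _ (boxCoact Y.coact (boxCoact Z.coact X.coact)) =
    act _ (boxCoact Y.coact (boxCoact Z.coact X.coact)) at h8
  rw [h1, h2, ← h3, ← h4, reassoc_of% h5, reassoc_of% h7, h8]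
  simp

theorem hexagon_rev (X Y Z : Comod A) :
    (α_ X.X Y.X Z.X).inv ≫ (braidIso (X ⊗ Y) Z).hom ≫ (α_ Z.X X.X Y.X).inv =
      X.X ◁ (braidIso Y Z).hom ≫ (α_ X.X Z.X Y.X).inv ≫ (braidIso X Z).hom ▷ Y.X := by
  have h1 := act_box_right μ[A] Z.coact (boxCoact X.coact Y.coact) coelt
  have h2 := act_box_assoc Z.coact X.coact Y.coact ((α_ A A A).hom ≫ A ◁ μ[A] ≫ coelt)
  rw [Iso.inv_hom_id_assoc] at h2
  have h3 := act_box_tensor X.coact (boxCoact Z.coact Y.coact) ε[A] coelt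
  have h4 := act_box_tensor (boxCoact Z.coact X.coact) Y.coact coelt ε[A]
  have h5 := act_box_assoc X.coact Z.coact Y.coact
    ((α_ A A A).hom ≫ (ε[A] ⊗ₘ coelt) ≫ (λ_ (𝟙_ C)).hom)
  rw [Iso.inv_hom_id_assoc] at h5
  rw [act_counit _ X.counit_coact, id_tensorHom] at h3
  rw [act_counit _ Y.counit_coact, tensorHom_id] at h4
  have h7 := act_box_nat_left (boxCoact X.coact Z.coact)
    (boxCoact Z.coact X.coact ≫ (β_ A A).hom ▷ (Z.X ⊗ X.X)) Y.coact (β_ X.X Z.X).hom (box_swap _ _)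
    ((α_ A A A).hom ≫ (ε[A] ⊗ₘ coelt) ≫ (λ_ (𝟙_ C)).hom)
  rw [act_box_left] at h7
  have h8 := act_comp ((β_ A A).hom ▷ A ≫ (α_ A A A).hom ≫ (ε[A] ⊗ₘ coelt) ≫ (λ_ (𝟙_ C)).hom)
    ((coelt ⊗ₘ ε[A]) ≫ (λ_ (𝟙_ C)).hom) _ (boxCoact_coassoc (box Z X) Y)
  change act _ (boxCoact (boxCoact Z.coact X.coact) Y.coact) ≫
    act _ (boxCoact (boxCoact Z.coact X.coact) Y.coact) =
    act _ (boxCoact (boxCoact Z.coact X.coact) Y.coact) at h8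
  have h9 : (β_ A A).hom ▷ A ≫ (α_ A A A).hom ≫ (ε[A] ⊗ₘ coelt) ≫ (λ_ (𝟙_ C)).hom =
      (A ◁ ε[A] ≫ (ρ_ A).hom) ▷ A ≫ coelt := by
    rw [MonoidalCategory.tensorHom_def, Category.assoc, leftUnitor_naturality]
    have e : (β_ A A).hom ≫ ε[A] ▷ A ≫ (λ_ A).hom = A ◁ ε[A] ≫ (ρ_ A).hom := by
      rw [← braiding_naturality_right_assoc]; simp
    rw [← e]
    simp
  have h10 : (coelt ⊗ₘ ε[A]) ≫ (λ_ (𝟙_ C)).hom =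
      (A ⊗ A) ◁ ε[A] ≫ (ρ_ (A ⊗ A)).hom ≫ coelt := by
    rw [MonoidalCategory.tensorHom_def', Category.assoc, unitors_equal, rightUnitor_naturality]
  rw [h9, h10, conv_right, ← h10] at h8
  rw [h9] at h7
  rw [braidIso_hom, braidIso_hom, braidIso_hom, tensorObj_coact']
  simp only [tensorObj_X, Category.assoc, comp_whiskerRight, MonoidalCategory.whiskerLeft_comp]
  have h2' : act (A ◁ μ[A] ≫ coelt) (boxCoact Z.coact (boxCoact X.coact Y.coact)) ≫
      (α_ Z.X X.X Y.X).inv = (α_ Z.X X.X Y.X).inv ≫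
        act ((α_ A A A).hom ≫ A ◁ μ[A] ≫ coelt) (boxCoact (boxCoact Z.coact X.coact) Y.coact) := by
    rw [Iso.comp_inv_eq, Category.assoc, h2, Iso.inv_hom_id_assoc]
  have h5' : act ((ε[A] ⊗ₘ coelt) ≫ (λ_ (𝟙_ C)).hom) (boxCoact X.coact (boxCoact Z.coact Y.coact)) ≫
      (α_ X.X Z.X Y.X).inv = (α_ X.X Z.X Y.X).inv ≫
        act ((α_ A A A).hom ≫ (ε[A] ⊗ₘ coelt) ≫ (λ_ (𝟙_ C)).hom)
          (boxCoact (boxCoact X.coact Z.coact) Y.coact) := by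
    rw [Iso.comp_inv_eq, Category.assoc, h5, Iso.inv_hom_id_assoc]
  rw [h1, h2', ← h3, ← h4, reassoc_of% h5', reassoc_of% h7, h8]
  simp

instance : BraidedCategory (Comod A) where
  braiding := braiding
  braiding_naturality_right X {Y Z} g := hom_ext (by
    have h := braiding_natural (𝟙 X) g
    simp only [id_f, id_tensorHom, tensorHom_id] at h
    exact h)
  braiding_naturality_left g Z := hom_ext (by
    have h := braiding_natural g (𝟙 Z)
    simp only [id_f, id_tensorHom, tensorHom_id] at h
    exact h)
  hexagon_forward X Y Z := hom_ext (hexagon_fwd X Y Z)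
  hexagon_reverse X Y Z := hom_ext (hexagon_rev X Y Z)

end Braided

end Comod

namespace Comod

section Cofree

variable {C : Type u} [Category.{v} C] [MonoidalCategory C]

/-- A comonoid as a comodule over itself. -/
def regular (A : C) [ComonObj A] : Comod A where
  X := A
  coact := Δ[A]
  counit_coact := ComonObj.counit_comul A
  coact_coact := ComonObj.comul_assoc A

/-- The cofree comodule on an object. -/
def cofree (A : C) [ComonObj A] (X : C) : Comod A where
  X := A ⊗ X
  coact := Δ[A] ▷ X ≫ (α_ A A X).hom
  counit_coact := by
    rw [Category.assoc, ← associator_naturality_left, ← comp_whiskerRight_assoc,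
      ComonObj.counit_comul]
    simp
  coact_coact := by
    have h := ComonObj.comul_assoc A
    simp only [MonoidalCategory.whiskerLeft_comp, Category.assoc]
    rw [← associator_naturality_left_assoc, ← associator_naturality_middle_assoc,
      ← comp_whiskerRight_assoc, h]
    simp

end Cofree

section Semidirect

variable {C : Type u} [Category.{v} C] [MonoidalCategory C]

/-- The morphism `W ⊗ t ⊗ Z : (W ⊗ X) ⊗ (Y ⊗ Z) ⟶ (W ⊗ Y) ⊗ (X ⊗ Z)`. -/
def middle (W : C) {X Y : C} (t : X ⊗ Y ⟶ Y ⊗ X) (Z : C) :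
    (W ⊗ X) ⊗ (Y ⊗ Z) ⟶ (W ⊗ Y) ⊗ (X ⊗ Z) :=
  (α_ W X (Y ⊗ Z)).hom ≫ W ◁ (α_ X Y Z).inv ≫ W ◁ t ▷ Z ≫ W ◁ (α_ Y X Z).hom ≫
    (α_ W Y (X ⊗ Z)).inv

theorem comp_coassoc_aux {H A X : C} {χ : X ⟶ H ⊗ X} {a : X ⟶ A ⊗ X} {D : H ⟶ H ⊗ H}
    {d : A ⟶ A ⊗ A} {t : H ⊗ A ⟶ A ⊗ H}
    (h1 : χ ≫ H ◁ χ = χ ≫ D ▷ X ≫ (α_ H H X).hom)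
    (h2 : a ≫ A ◁ χ = χ ≫ H ◁ a ≫ (α_ H A X).inv ≫ t ▷ X ≫ (α_ A H X).hom)
    (h3 : a ≫ A ◁ a = a ≫ d ▷ X ≫ (α_ A A X).hom) :
    (χ ≫ H ◁ a ≫ (α_ H A X).inv) ≫ (H ⊗ A) ◁ (χ ≫ H ◁ a ≫ (α_ H A X).inv) =
      (χ ≫ H ◁ a ≫ (α_ H A X).inv) ≫ ((D ⊗ₘ d) ≫ middle H t A) ▷ X ≫
        (α_ (H ⊗ A) (H ⊗ A) X).hom := by
  calc _ = χ ≫ H ◁ (a ≫ A ◁ χ) ≫ H ◁ A ◁ (H ◁ a ≫ (α_ H A X).inv) ≫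
        (α_ H A ((H ⊗ A) ⊗ X)).inv := by
        simp
    _ = (χ ≫ H ◁ χ) ≫ H ◁ (H ◁ a ≫ (α_ H A X).inv ≫ t ▷ X ≫ (α_ A H X).hom) ≫
        H ◁ A ◁ (H ◁ a ≫ (α_ H A X).inv) ≫ (α_ H A ((H ⊗ A) ⊗ X)).inv := by
        rw [h2]; simp
    _ = χ ≫ D ▷ X ≫ (α_ H H X).hom ≫ H ◁ H ◁ a ≫ H ◁ (α_ H A X).inv ≫
        H ◁ (t ▷ X ≫ (A ⊗ H) ◁ a) ≫ 𝟙 _ ⊗≫ 𝟙 ((H ⊗ A) ⊗ (H ⊗ A) ⊗ X) := by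
        rw [h1]; monoidal
    _ = χ ≫ D ▷ X ≫ (α_ H H X).hom ≫ H ◁ H ◁ (a ≫ A ◁ a) ⊗≫
        H ◁ t ▷ A ▷ X ⊗≫ 𝟙 ((H ⊗ A) ⊗ (H ⊗ A) ⊗ X) := by
        rw [← whisker_exchange]; monoidal
    _ = χ ≫ (D ▷ X ≫ (H ⊗ H) ◁ a) ⊗≫ H ◁ H ◁ d ▷ X ⊗≫
        H ◁ t ▷ A ▷ X ⊗≫ 𝟙 ((H ⊗ A) ⊗ (H ⊗ A) ⊗ X) := by
        rw [h3]; monoidal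
    _ = _ := by
        rw [← whisker_exchange, MonoidalCategory.tensorHom_def, middle]; monoidal

theorem comp_counit_aux {H A X : C} {χ : X ⟶ H ⊗ X} {a : X ⟶ A ⊗ X} {e : H ⟶ 𝟙_ C}
    {d : A ⟶ 𝟙_ C} (h1 : χ ≫ e ▷ X = (λ_ X).inv) (h2 : a ≫ d ▷ X = (λ_ X).inv) :
    (χ ≫ H ◁ a ≫ (α_ H A X).inv) ≫ ((e ⊗ₘ d) ≫ (λ_ (𝟙_ C)).hom) ▷ X = (λ_ X).inv := by
  calc _ = χ ≫ H ◁ (a ≫ d ▷ X) ≫ (e ▷ (𝟙_ C ⊗ X)) ⊗≫ 𝟙 (𝟙_ C ⊗ X) := by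
        rw [MonoidalCategory.tensorHom_def']; monoidal
    _ = (χ ≫ e ▷ X) ⊗≫ 𝟙 (𝟙_ C ⊗ X) := by
        rw [h2]; monoidal
    _ = _ := by rw [h1]; monoidal

variable [SymmetricCategory C] {A : C} [BimonObj A]

/-- The morphism `X ⊗ A ⟶ A ⊗ X`, `x ⊗ a ↦ x_A a ⊗ x_X`. -/
def tau (X : Comod A) : X.X ⊗ A ⟶ A ⊗ X.X :=
  X.coact ▷ A ≫ (α_ A X.X A).hom ≫ A ◁ (β_ X.X A).hom ≫ (α_ A A X.X).inv ≫ μ[A] ▷ X.X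

variable [BraidingCoelement A]

/-- The underlying object of the semidirect product `H ⋊ A`. -/
def semidirect (H : Comod A) : C := H.X ⊗ A

variable (H : Comod A)

section

variable [BimonObj H]

/-- The unit of `H`, as a morphism of the base category. -/
abbrev unitV : 𝟙_ C ⟶ H.X := Hom.f η[H]
/-- The multiplication of `H`, as a morphism of the base category. -/
abbrev mulV : H.X ⊗ H.X ⟶ H.X := Hom.f μ[H]
/-- The counit of `H`, as a morphism of the base category. -/
abbrev counitV : H.X ⟶ 𝟙_ C := Hom.f ε[H]
/-- The comultiplication of `H`, as a morphism of the base category. -/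
abbrev comulV : H.X ⟶ H.X ⊗ H.X := Hom.f Δ[H]

end

/-- The braiding `A ⊗ H ⟶ H ⊗ A` of the regular comodule `A` with `H`. -/
abbrev swapV : A ⊗ H.X ⟶ H.X ⊗ A := Hom.f (β_ (regular A) H).hom

variable {H} [BimonObj H]

theorem tensor_coact_tau (X Y : Comod A) : (X ⊗ Y).coact =
    X.X ◁ Y.coact ≫ (α_ X.X A Y.X).inv ≫ tau X ▷ Y.X ≫ (α_ A X.X Y.X).hom := by
  rw [tensorObj_coact]
  simp [tau, tensorμ, MonoidalCategory.tensorHom_def']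

/-- The coaction `(1 ⊗ α) ∘ χ` of `H ⋊ A` on an `H`-comodule `((B, α), χ)`. -/
def compCoact (B : Comod H) : B.X.X ⟶ (H.X ⊗ A) ⊗ B.X.X :=
  B.coact.f ≫ H.X ◁ B.X.coact ≫ (α_ H.X A B.X.X).inv

theorem coact_f_coassoc (B : Comod H) : (B.coact.f : B.X.X ⟶ H.X ⊗ B.X.X) ≫ H.X ◁ B.coact.f =
    B.coact.f ≫ comulV H ▷ B.X.X ≫ (α_ H.X H.X B.X.X).hom :=
  congrArg Hom.f B.coact_coact

theorem coact_f_counit (B : Comod H) : (B.coact.f : B.X.X ⟶ H.X ⊗ B.X.X) ≫ counitV H ▷ B.X.X =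
    (λ_ B.X.X).inv :=
  congrArg Hom.f B.counit_coact

theorem coact_f_comm (B : Comod H) :
    B.X.coact ≫ A ◁ (B.coact.f : B.X.X ⟶ H.X ⊗ B.X.X) =
    B.coact.f ≫ H.X ◁ B.X.coact ≫ (α_ H.X A B.X.X).inv ≫ tau H ▷ B.X.X ≫
      (α_ A H.X B.X.X).hom := by
  have h := B.coact.comm
  rwa [tensor_coact_tau] at h

theorem compCoact_coassoc (B : Comod H) :
    compCoact B ≫ (H.X ⊗ A) ◁ compCoact B =
      compCoact B ≫ ((comulV H ⊗ₘ Δ[A]) ≫ middle H.X (tau H) A) ▷ B.X.X ≫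
        (α_ (H.X ⊗ A) (H.X ⊗ A) B.X.X).hom := by
  have h1 := coact_f_coassoc B
  have h2 := coact_f_comm B
  have h3 := B.X.coact_coact
  exact comp_coassoc_aux h1 h2 h3

theorem compCoact_counit (B : Comod H) :
    compCoact B ≫ ((counitV H ⊗ₘ ε[A]) ≫ (λ_ (𝟙_ C)).hom) ▷ B.X.X = (λ_ B.X.X).inv := by
  have h1 := coact_f_counit B
  have h2 := B.X.counit_coact
  exact comp_counit_aux h1 h2

theorem compCoact_cofree : compCoact (cofree H (regular A)) =
    (comulV H ⊗ₘ Δ[A]) ≫ middle H.X (tau H) A := by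
  have e : (H ⊗ regular A).coact = H.X ◁ Δ[A] ≫ (α_ H.X A A).inv ≫ tau H ▷ A ≫ (α_ A H.X A).hom :=
    tensor_coact_tau H (regular A)
  have e2 : compCoact (cofree H (regular A)) = (comulV H ▷ A ≫ (α_ H.X H.X A).hom) ≫
    H.X ◁ (H ⊗ regular A).coact ≫ (α_ H.X A (H.X ⊗ A)).inv := rfl
  rw [e2, e, MonoidalCategory.tensorHom_def, middle]
  monoidal

theorem tau_counit : tau H ≫ A ◁ counitV H = (β_ H.X A).hom ≫ A ◁ counitV H := by
  have h := Hom.comm ε[H]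
  have h2 : H.coact ≫ A ◁ counitV H = counitV H ≫ (λ_ (𝟙_ C)).inv ≫ η[A] ▷ 𝟙_ C := h
  have h3 : η[A] ▷ A ≫ μ[A] = (λ_ A).hom := MonObj.one_mul A
  calc tau H ≫ A ◁ counitV H = (H.coact ≫ A ◁ counitV H) ▷ A ≫ (α_ A (𝟙_ C) A).hom ≫
        A ◁ (β_ (𝟙_ C) A).hom ≫ (α_ A A (𝟙_ C)).inv ≫ μ[A] ▷ 𝟙_ C := by
        simp only [tau, Category.assoc, comp_whiskerRight]
        rw [← whisker_exchange, ← associator_inv_naturality_right_assoc,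
          ← MonoidalCategory.whiskerLeft_comp_assoc, ← braiding_naturality_left]
        simp
    _ = counitV H ▷ A ≫ ((λ_ (𝟙_ C)).inv ≫ η[A] ▷ 𝟙_ C) ▷ A ≫ (α_ A (𝟙_ C) A).hom ≫
        A ◁ (β_ (𝟙_ C) A).hom ≫ (α_ A A (𝟙_ C)).inv ≫ μ[A] ▷ 𝟙_ C := by
        rw [h2, comp_whiskerRight, Category.assoc]
    _ = counitV H ▷ A ≫ (λ_ A).hom ≫ (λ_ A).inv ≫ (η[A] ▷ A ≫ μ[A]) ≫ (ρ_ A).inv := by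
        rw [braiding_tensorUnit_left]; monoidal
    _ = _ := by
        rw [h3, ← braiding_naturality_left, braiding_tensorUnit_left]; simp

theorem act_unit_coact {X : C} (c : X ⟶ A ⊗ X) (Y : C) :
    act BraidingCoelement.coelt (boxCoact c ((λ_ Y).inv ≫ η[A] ▷ Y)) =
      act ((ρ_ A).inv ≫ A ◁ η[A] ≫ BraidingCoelement.coelt) c ▷ Y := by
  have h1 : A ◁ η[A] ≫ BraidingCoelement.coelt =
      (((ρ_ A).inv ≫ A ◁ η[A] ≫ BraidingCoelement.coelt) ⊗ₘ 𝟙 (𝟙_ C)) ≫ (λ_ (𝟙_ C)).hom := by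
    rw [tensorHom_id, unitors_equal, rightUnitor_naturality]; simp
  have h2 : act (𝟙 (𝟙_ C)) (λ_ Y).inv = 𝟙 Y := by simp [act]
  rw [act_box_right]
  conv_lhs => rw [h1, act_box_tensor, h2, tensorHom_id]

theorem coelt_one : (ρ_ A).inv ≫ A ◁ η[A] ≫ BraidingCoelement.coelt = ε[A] := by
  have h1 : (β_ (𝟙_ (Comod A)) (regular A)).hom.f = (λ_ A).hom ≫ (ρ_ A).inv :=
    congrArg Hom.f (braiding_tensorUnit_left (regular A))
  have h2 : (β_ (𝟙_ (Comod A)) (regular A)).hom.f = (β_ (𝟙_ C) A).hom ≫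
      act BraidingCoelement.coelt (boxCoact Δ[A] ((λ_ (𝟙_ C)).inv ≫ η[A] ▷ 𝟙_ C)) :=
    braidIso_hom (𝟙_ (Comod A)) (regular A)
  rw [h1, ← braiding_tensorUnit_left, act_unit_coact] at h2
  have h3 : act ((ρ_ A).inv ≫ A ◁ η[A] ≫ BraidingCoelement.coelt) Δ[A] ▷ 𝟙_ C = 𝟙 A ▷ 𝟙_ C := by
    rw [← cancel_epi (β_ (𝟙_ C) A).hom, ← h2]; simp
  have h4 : act ((ρ_ A).inv ≫ A ◁ η[A] ≫ BraidingCoelement.coelt) Δ[A] = 𝟙 A := by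
    rw [← cancel_epi (ρ_ A).hom, ← rightUnitor_naturality, h3]; simp
  have h5 : ∀ ψ : A ⟶ 𝟙_ C, act ψ Δ[A] ≫ ε[A] = ψ := by
    intro ψ
    simp only [act, Category.assoc]
    rw [← leftUnitor_naturality, ← whisker_exchange_assoc, ComonObj.comul_counit_assoc,
      unitors_equal, rightUnitor_naturality]
    simp
  rw [← h5 (_ ≫ _), h4, Category.id_comp]

variable (A) in
/-- The base object with the trivial coaction. -/
def triv (X : C) : Comod A where
  X := X
  coact := (λ_ X).inv ≫ η[A] ▷ X
  counit_coact := by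
    rw [Category.assoc, ← comp_whiskerRight, BimonObj.one_counit]; simp
  coact_coact := by
    have := Bimon.one_comul A
    simp only [Category.assoc]
    rw [← comp_whiskerRight_assoc, this]
    simp only [MonoidalCategory.tensorHom_def]
    monoidal

theorem braid_triv (X : C) (M : Comod A) :
    (β_ (triv A X) M).hom.f = (β_ X M.X).hom := by
  have h : (β_ (triv A X) M).hom.f = (β_ X M.X).hom ≫
      act BraidingCoelement.coelt (boxCoact M.coact ((λ_ X).inv ≫ η[A] ▷ X)) :=
    braidIso_hom (triv A X) M
  rw [h, act_unit_coact, coelt_one, act_counit _ M.counit_coact, id_whiskerRight]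
  exact Category.comp_id _

/-- The coaction of a comodule as a morphism of comodules. -/
def coactHom (E : Comod A) : E ⟶ regular A ⊗ triv A E.X where
  f := E.coact
  comm := by
    have h := E.coact_coact
    have e : (regular A ⊗ triv A E.X).coact = Δ[A] ▷ E.X ≫ (α_ A A E.X).hom := by
      have e0 : (regular A ⊗ triv A E.X).coact = (Δ[A] ⊗ₘ ((λ_ E.X).inv ≫ η[A] ▷ E.X)) ≫
        tensorμ A A A E.X ≫ μ[A] ▷ (A ⊗ E.X) := rfl
      rw [e0]
      have e1 : (Δ[A] ⊗ₘ ((λ_ E.X).inv ≫ η[A] ▷ E.X)) =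
          (Δ[A] ⊗ₘ (λ_ E.X).inv) ≫ ((𝟙 A ⊗ₘ 𝟙 A) ⊗ₘ (η[A] ⊗ₘ 𝟙 E.X)) := by
        simp only [← id_tensorHom, ← tensorHom_id, tensorHom_comp_tensorHom,
          tensorHom_comp_tensorHom_assoc, Category.id_comp, Category.comp_id, id_tensorHom_id]
      have e2 : ((𝟙 A ⊗ₘ η[A]) ⊗ₘ (𝟙 A ⊗ₘ 𝟙 E.X)) ≫ μ[A] ▷ (A ⊗ E.X) =
          (A ◁ η[A] ≫ μ[A]) ▷ (A ⊗ E.X) := by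
        simp only [← id_tensorHom, ← tensorHom_id, tensorHom_comp_tensorHom,
          tensorHom_comp_tensorHom_assoc, Category.id_comp, Category.comp_id, id_tensorHom_id]
      rw [e1, Category.assoc, tensorμ_natural_assoc, e2, MonObj.mul_one, tensorμ,
        braiding_tensorUnit_right, MonoidalCategory.tensorHom_def]
      monoidal
    rw [e]
    exact h

theorem braid_coact (E : Comod A) : (β_ E H).hom.f ≫ H.X ◁ E.coact =
    E.coact ▷ H.X ≫ (α_ A E.X H.X).hom ≫ A ◁ (β_ E.X H.X).hom ≫ (α_ A H.X E.X).inv ≫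
      swapV H ▷ E.X ≫ (α_ H.X A E.X).hom := by
  have h1 : coactHom E ▷ H ≫ (β_ (regular A ⊗ triv A E.X) H).hom =
    (β_ E H).hom ≫ H ◁ coactHom E := braiding_naturality_left _ _
  rw [braiding_tensor_left_hom] at h1
  have h := congrArg Hom.f h1
  simp only [comp_f, whiskerRight_f, whiskerLeft_f, associator_hom_f, associator_inv_f,
    braid_triv] at h
  exact h.symm

instance : MonObj (regular A) where
  one := ⟨η[A], by
    have h := Bimon.one_comul A
    change ((λ_ (𝟙_ C)).inv ≫ η[A] ▷ 𝟙_ C) ≫ A ◁ η[A] = η[A] ≫ Δ[A]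
    rw [h, MonoidalCategory.tensorHom_def, Category.assoc]⟩
  mul := ⟨μ[A], by
    have h := BimonObj.mul_comul (M := A)
    change ((Δ[A] ⊗ₘ Δ[A]) ≫ tensorμ A A A A ≫ μ[A] ▷ (A ⊗ A)) ≫ A ◁ μ[A] = μ[A] ≫ Δ[A]
    rw [h, MonoidalCategory.tensorHom_def μ[A] μ[A]]
    simp [tensorμ]⟩
  one_mul := hom_ext (MonObj.one_mul A)
  mul_one := hom_ext (MonObj.mul_one A)
  mul_assoc := hom_ext (MonObj.mul_assoc A)

theorem mul_tensor_f (E : Comod A) [MonObj E] : Hom.f μ[H ⊗ E] =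
    middle H.X ((β_ E H).hom.f) E.X ≫ (mulV H ⊗ₘ Hom.f μ[E]) := by
  rw [MonObj.tensorObj.mul_def]
  rfl

theorem one_tensor_f (E : Comod A) [MonObj E] : Hom.f η[H ⊗ E] =
    (λ_ (𝟙_ C)).inv ≫ (unitV H ⊗ₘ Hom.f η[E]) := by
  rw [MonObj.tensorObj.one_def]
  rfl

theorem mul_coact_aux {H A E : C} {a : E ⟶ A ⊗ E} {s : E ⊗ H ⟶ H ⊗ E} {t : A ⊗ H ⟶ H ⊗ A}
    (h : s ≫ H ◁ a = a ▷ H ≫ (α_ A E H).hom ≫ A ◁ (β_ E H).hom ≫ (α_ A H E).inv ≫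
      t ▷ E ≫ (α_ H A E).hom) :
    middle H s E ≫ (H ⊗ H) ◁ ((a ⊗ₘ a) ≫ tensorμ A E A E) =
      ((H ◁ a ≫ (α_ H A E).inv) ⊗ₘ (H ◁ a ≫ (α_ H A E).inv)) ≫
        tensorμ (H ⊗ A) E (H ⊗ A) E ≫ middle H t A ▷ (E ⊗ E) ≫
          (α_ (H ⊗ H) (A ⊗ A) (E ⊗ E)).hom := by
  calc _ = 𝟙 _ ⊗≫ H ◁ (s ≫ H ◁ a) ▷ E ⊗≫ (H ⊗ H ⊗ A ⊗ E) ◁ a ⊗≫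
        (H ⊗ H ⊗ A) ◁ (β_ E A).hom ▷ E ⊗≫ 𝟙 _ := by
        rw [middle, MonoidalCategory.tensorHom_def, tensorμ]; monoidal
    _ = 𝟙 _ ⊗≫ H ◁ a ▷ (H ⊗ E) ⊗≫ (H ⊗ A) ◁ (β_ E H).hom ▷ E ⊗≫
        H ◁ (t ▷ (E ⊗ E) ≫ (H ⊗ A) ◁ (E ◁ a ≫ (α_ E A E).inv ≫ (β_ E A).hom ▷ E)) ⊗≫ 𝟙 _ := by
        rw [h]; monoidal
    _ = 𝟙 _ ⊗≫ H ◁ a ▷ (H ⊗ E) ⊗≫ (H ⊗ A) ◁ ((β_ E H).hom ▷ E ≫ (H ⊗ E) ◁ a) ⊗≫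
        (H ⊗ A ⊗ H) ◁ (β_ E A).hom ▷ E ⊗≫ H ◁ t ▷ (A ⊗ E ⊗ E) ⊗≫ 𝟙 _ := by
        rw [← whisker_exchange]; monoidal
    _ = 𝟙 _ ⊗≫ H ◁ a ▷ (H ⊗ E) ⊗≫ (H ⊗ A) ◁ ((E ⊗ H) ◁ a ≫ (β_ E H).hom ▷ (A ⊗ E)) ⊗≫
        (H ⊗ A ⊗ H) ◁ (β_ E A).hom ▷ E ⊗≫ H ◁ t ▷ (A ⊗ E ⊗ E) ⊗≫ 𝟙 _ := by
        rw [← whisker_exchange]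
    _ = _ := by
        rw [middle, MonoidalCategory.tensorHom_def, tensorμ, braiding_tensor_right_hom]; monoidal

theorem mul_coact_aux2 {H A E : C} {a : E ⟶ A ⊗ E} {s : E ⊗ H ⟶ H ⊗ E} {t : A ⊗ H ⟶ H ⊗ A}
    (h : s ≫ H ◁ a = a ▷ H ≫ (α_ A E H).hom ≫ A ◁ (β_ E H).hom ≫ (α_ A H E).inv ≫
      t ▷ E ≫ (α_ H A E).hom) {m : H ⊗ H ⟶ H} {n : E ⊗ E ⟶ E} {k : A ⊗ A ⟶ A}
    (h' : ((a ⊗ₘ a) ≫ tensorμ A E A E ≫ k ▷ (E ⊗ E)) ≫ A ◁ n = n ≫ a) :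
    (middle H s E ≫ (m ⊗ₘ n)) ≫ H ◁ a ≫ (α_ H A E).inv =
      ((H ◁ a ≫ (α_ H A E).inv) ⊗ₘ (H ◁ a ≫ (α_ H A E).inv)) ≫
        tensorμ (H ⊗ A) E (H ⊗ A) E ≫ ((middle H t A ≫ (m ⊗ₘ k)) ⊗ₘ n) := by
  have h2 := mul_coact_aux h
  calc _ = middle H s E ≫ m ▷ (E ⊗ E) ≫ H ◁ (n ≫ a) ≫ (α_ H A E).inv := by
        rw [MonoidalCategory.tensorHom_def]; simp
    _ = (middle H s E ≫ (H ⊗ H) ◁ ((a ⊗ₘ a) ≫ tensorμ A E A E)) ≫ m ▷ ((A ⊗ A) ⊗ (E ⊗ E)) ≫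
        H ◁ (k ▷ (E ⊗ E) ≫ A ◁ n) ≫ (α_ H A E).inv := by
        rw [← h']
        simp only [MonoidalCategory.whiskerLeft_comp, Category.assoc]
        rw [whisker_exchange_assoc, whisker_exchange_assoc]
    _ = _ := by
        rw [h2, MonoidalCategory.tensorHom_def (_ ≫ _) n, MonoidalCategory.tensorHom_def m k]; simp

theorem mul_coact (E : Comod A) [MonObj E] :
    Hom.f μ[H ⊗ E] ≫ H.X ◁ E.coact ≫ (α_ H.X A E.X).inv =
      ((H.X ◁ E.coact ≫ (α_ H.X A E.X).inv) ⊗ₘ (H.X ◁ E.coact ≫ (α_ H.X A E.X).inv)) ≫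
        tensorμ (H.X ⊗ A) E.X (H.X ⊗ A) E.X ≫
          ((middle H.X (swapV H) A ≫ (mulV H ⊗ₘ μ[A])) ⊗ₘ Hom.f μ[E]) := by
  rw [mul_tensor_f]
  exact mul_coact_aux2 (braid_coact E) (Hom.comm μ[E])

end Semidirect

end Comod

namespace Comod

section SemidirectBimonoid

variable {C : Type u} [Category.{v} C] [MonoidalCategory C]

theorem comul_counit_aux {H A : C} [SymmetricCategory C] {D : H ⟶ H ⊗ H} {d : A ⟶ A ⊗ A}
    {t : H ⊗ A ⟶ A ⊗ H} {e : H ⟶ 𝟙_ C} {f : A ⟶ 𝟙_ C} (h1 : D ≫ H ◁ e = (ρ_ H).inv)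
    (h2 : d ≫ A ◁ f = (ρ_ A).inv) (h3 : t ≫ A ◁ e = (β_ H A).hom ≫ A ◁ e) :
    ((D ⊗ₘ d) ≫ middle H t A) ≫ (H ⊗ A) ◁ ((e ⊗ₘ f) ≫ (λ_ (𝟙_ C)).hom) = (ρ_ (H ⊗ A)).inv := by
  calc _ = (D ⊗ₘ d) ⊗≫ H ◁ (t ≫ A ◁ e) ▷ A ⊗≫ (H ⊗ A) ◁ f ⊗≫ 𝟙 _ := by
        rw [middle, MonoidalCategory.tensorHom_def e f]; monoidal
    _ = (D ⊗ₘ d) ⊗≫ H ◁ (e ▷ A ≫ (β_ (𝟙_ C) A).hom) ▷ A ⊗≫ (H ⊗ A) ◁ f ⊗≫ 𝟙 _ := by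
        rw [h3, ← braiding_naturality_left]
    _ = D ▷ A ⊗≫ (H ⊗ H) ◁ d ⊗≫ (H ◁ e) ▷ (A ⊗ A) ⊗≫ (H ⊗ A) ◁ f ⊗≫ 𝟙 _ := by
        rw [braiding_tensorUnit_left, MonoidalCategory.tensorHom_def]; monoidal
    _ = D ▷ A ⊗≫ ((H ⊗ H) ◁ d ≫ (H ◁ e) ▷ (A ⊗ A)) ⊗≫ (H ⊗ A) ◁ f ⊗≫ 𝟙 _ := by
        monoidal
    _ = (D ≫ H ◁ e) ▷ A ⊗≫ H ◁ (d ≫ A ◁ f) ⊗≫ 𝟙 _ := by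
        rw [whisker_exchange]; monoidal
    _ = _ := by rw [h1, h2]; monoidal

theorem one_comul_aux {H A E : C} {a : E ⟶ A ⊗ E} {i : 𝟙_ C ⟶ H} {j : 𝟙_ C ⟶ A} {k : 𝟙_ C ⟶ E}
    (h : ((λ_ (𝟙_ C)).inv ≫ j ▷ 𝟙_ C) ≫ A ◁ k = k ≫ a) :
    ((λ_ (𝟙_ C)).inv ≫ (i ⊗ₘ k)) ≫ H ◁ a ≫ (α_ H A E).inv =
      (λ_ (𝟙_ C)).inv ≫ (((λ_ (𝟙_ C)).inv ≫ (i ⊗ₘ j)) ⊗ₘ k) := by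
  calc _ = (λ_ (𝟙_ C)).inv ≫ i ▷ 𝟙_ C ≫ H ◁ (k ≫ a) ≫ (α_ H A E).inv := by
        rw [MonoidalCategory.tensorHom_def]; simp
    _ = _ := by
        rw [← h, MonoidalCategory.tensorHom_def, MonoidalCategory.tensorHom_def]; monoidal

variable [SymmetricCategory C] {A : C} [BimonObj A] [BraidingCoelement A]
variable (H : Comod A) [BimonObj H]

/-- The unit of `H ⋊ A`. -/
def semiOne : 𝟙_ C ⟶ H.X ⊗ A := (λ_ (𝟙_ C)).inv ≫ (unitV H ⊗ₘ η[A])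

/-- The multiplication of `H ⋊ A`. -/
def semiMul : (H.X ⊗ A) ⊗ (H.X ⊗ A) ⟶ H.X ⊗ A := middle H.X (swapV H) A ≫ (mulV H ⊗ₘ μ[A])

/-- The counit of `H ⋊ A`. -/
def semiCounit : H.X ⊗ A ⟶ 𝟙_ C := (counitV H ⊗ₘ ε[A]) ≫ (λ_ (𝟙_ C)).hom

/-- The comultiplication of `H ⋊ A`. -/
def semiComul : H.X ⊗ A ⟶ (H.X ⊗ A) ⊗ (H.X ⊗ A) := (comulV H ⊗ₘ Δ[A]) ≫ middle H.X (tau H) A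

theorem semiOne_eq : semiOne H = Hom.f η[H ⊗ regular A] := (one_tensor_f (regular A)).symm

theorem semiMul_eq : semiMul H = Hom.f μ[H ⊗ regular A] := (mul_tensor_f (regular A)).symm

theorem semi_one_mul : semiOne H ▷ (H.X ⊗ A) ≫ semiMul H = (λ_ (H.X ⊗ A)).hom := by
  rw [semiOne_eq, semiMul_eq]
  exact congrArg Hom.f (MonObj.one_mul (H ⊗ regular A))

theorem semi_mul_one : (H.X ⊗ A) ◁ semiOne H ≫ semiMul H = (ρ_ (H.X ⊗ A)).hom := by
  rw [semiOne_eq, semiMul_eq]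
  exact congrArg Hom.f (MonObj.mul_one (H ⊗ regular A))

theorem semi_mul_assoc : semiMul H ▷ (H.X ⊗ A) ≫ semiMul H =
    (α_ (H.X ⊗ A) (H.X ⊗ A) (H.X ⊗ A)).hom ≫ (H.X ⊗ A) ◁ semiMul H ≫ semiMul H := by
  rw [semiMul_eq]
  exact congrArg Hom.f (MonObj.mul_assoc (H ⊗ regular A))

theorem semi_counit_comul : semiComul H ≫ semiCounit H ▷ (H.X ⊗ A) = (λ_ (H.X ⊗ A)).inv := by
  rw [semiComul, ← compCoact_cofree]
  exact compCoact_counit (cofree H (regular A))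

theorem semi_comul_counit : semiComul H ≫ (H.X ⊗ A) ◁ semiCounit H = (ρ_ (H.X ⊗ A)).inv :=
  comul_counit_aux (congrArg Hom.f (ComonObj.comul_counit H)) (ComonObj.comul_counit A) tau_counit

theorem semi_comul_assoc : semiComul H ≫ (H.X ⊗ A) ◁ semiComul H =
    semiComul H ≫ semiComul H ▷ (H.X ⊗ A) ≫ (α_ (H.X ⊗ A) (H.X ⊗ A) (H.X ⊗ A)).hom := by
  have h := compCoact_coassoc (cofree H (regular A))
  rw [compCoact_cofree] at h
  exact h

theorem semiComul_eq : semiComul H = (comulV H ▷ A ≫ (α_ H.X H.X A).hom) ≫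
    H.X ◁ (H ⊗ regular A).coact ≫ (α_ H.X A (H.X ⊗ A)).inv :=
  compCoact_cofree.symm

instance : IsMonHom Δ[H] where
  one_hom := BimonObj.one_comul H
  mul_hom := by rw [BimonObj.mul_comul, MonObj.tensorObj.mul_def]

instance : IsMonHom ε[H] where
  one_hom := BimonObj.one_counit H
  mul_hom := by rw [BimonObj.mul_counit, Comon.tensorObj_counit]; simp

/-- The monoid morphism `Δ_H ⊗ 1 : H ⊗ A ⟶ H ⊗ (H ⊗ A)`. -/
def comulMap : H ⊗ regular A ⟶ H ⊗ (H ⊗ regular A) :=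
  Δ[H] ▷ regular A ≫ (α_ H H (regular A)).hom

instance : IsMonHom (comulMap H) := by unfold comulMap; infer_instance

/-- The monoid morphism `ε_H ⊗ 1 : H ⊗ A ⟶ A`. -/
def projMap : H ⊗ regular A ⟶ regular A :=
  ε[H] ▷ regular A ≫ (λ_ (regular A)).hom

instance : IsMonHom (projMap H) := by unfold projMap; infer_instance

theorem one_glue {M N P : C} {o : 𝟙_ C ⟶ M} {f : M ⟶ N} {g : N ⟶ P} {o' : 𝟙_ C ⟶ N}
    {r : 𝟙_ C ⟶ P} (h1 : o ≫ f = o') (h2 : o' ≫ g = r) : o ≫ f ≫ g = r := by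
  rw [reassoc_of% h1, h2]

theorem mul_glue {M N P : C} {m : M ⊗ M ⟶ M} {f : M ⟶ N} {g : N ⟶ P} {m' : N ⊗ N ⟶ N}
    {r : P ⊗ P ⟶ P} (h1 : m ≫ f = (f ⊗ₘ f) ≫ m') (h2 : m' ≫ g = (g ⊗ₘ g) ≫ r) :
    m ≫ f ≫ g = ((f ≫ g) ⊗ₘ (f ≫ g)) ≫ r := by
  rw [reassoc_of% h1, h2, tensorHom_comp_tensorHom_assoc]

theorem semi_one_comul : semiOne H ≫ semiComul H =
    (λ_ (𝟙_ C)).inv ≫ (semiOne H ⊗ₘ semiOne H) := by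
  have h1 : semiOne H ≫ comulV H ▷ A ≫ (α_ H.X H.X A).hom =
      (λ_ (𝟙_ C)).inv ≫ (unitV H ⊗ₘ semiOne H) := by
    rw [semiOne_eq]
    exact (congrArg Hom.f (IsMonHom.one_hom (comulMap H))).trans (one_tensor_f (H ⊗ regular A))
  have h2 : ((λ_ (𝟙_ C)).inv ≫ η[A] ▷ 𝟙_ C) ≫ A ◁ semiOne H =
      semiOne H ≫ (H ⊗ regular A).coact := by
    rw [semiOne_eq]
    exact Hom.comm η[H ⊗ regular A]
  rw [semiComul_eq]
  exact one_glue h1 (one_comul_aux h2)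

theorem semi_mul_comul : semiMul H ≫ semiComul H = (semiComul H ⊗ₘ semiComul H) ≫
    tensorμ (H.X ⊗ A) (H.X ⊗ A) (H.X ⊗ A) (H.X ⊗ A) ≫ (semiMul H ⊗ₘ semiMul H) := by
  have h1 : semiMul H ≫ comulV H ▷ A ≫ (α_ H.X H.X A).hom =
      ((comulV H ▷ A ≫ (α_ H.X H.X A).hom) ⊗ₘ (comulV H ▷ A ≫ (α_ H.X H.X A).hom)) ≫
        Hom.f μ[H ⊗ (H ⊗ regular A)] := by
    rw [semiMul_eq]
    exact congrArg Hom.f (IsMonHom.mul_hom (comulMap H))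
  have h2 := mul_coact (H := H) (H ⊗ regular A)
  rw [← semiMul_eq] at h2
  rw [semiComul_eq]
  exact mul_glue h1 h2

theorem semi_one_counit : semiOne H ≫ semiCounit H = 𝟙 (𝟙_ C) := by
  have h1 : unitV H ≫ counitV H = 𝟙 (𝟙_ C) := congrArg Hom.f (BimonObj.one_counit H)
  rw [semiOne, semiCounit, Category.assoc, tensorHom_comp_tensorHom_assoc, h1, BimonObj.one_counit]
  simp

theorem semiCounit_eq : semiCounit H = (counitV H ▷ A ≫ (λ_ A).hom) ≫ ε[A] := by
  rw [semiCounit, MonoidalCategory.tensorHom_def, Category.assoc, Category.assoc,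
    leftUnitor_naturality]

theorem semi_mul_counit : semiMul H ≫ semiCounit H =
    (semiCounit H ⊗ₘ semiCounit H) ≫ (λ_ (𝟙_ C)).hom := by
  have h1 : semiMul H ≫ counitV H ▷ A ≫ (λ_ A).hom =
      ((counitV H ▷ A ≫ (λ_ A).hom) ⊗ₘ (counitV H ▷ A ≫ (λ_ A).hom)) ≫ μ[A] := by
    rw [semiMul_eq]
    exact congrArg Hom.f (IsMonHom.mul_hom (projMap H))
  rw [semiCounit_eq, ← tensorHom_comp_tensorHom_assoc, ← Bimon.mul_counit A]
  rw [← Category.assoc (semiMul H), h1, Category.assoc]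

/-- The semidirect product `H ⋊ A`, a bimonoid in the base category. -/
instance : BimonObj (semidirect H) where
  one := semiOne H
  mul := semiMul H
  counit := semiCounit H
  comul := semiComul H
  one_mul := semi_one_mul H
  mul_one := semi_mul_one H
  mul_assoc := semi_mul_assoc H
  counit_comul := semi_counit_comul H
  comul_counit := semi_comul_counit H
  comul_assoc := semi_comul_assoc H
  mul_comul := semi_mul_comul H
  one_comul := semi_one_comul H
  mul_counit := semi_mul_counit H
  one_counit := semi_one_counit H

end SemidirectBimonoid
end Comod

namespace Comod

section Comparison

variable {C : Type u} [Category.{v} C] [MonoidalCategory C]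

theorem coact_mixed {M K L N : C} {b : N ⟶ M ⊗ N} {D : M ⟶ M ⊗ M}
    (h : b ≫ M ◁ b = b ≫ D ▷ N ≫ (α_ M M N).hom) (p : M ⟶ K) (q : M ⟶ L) :
    (b ≫ p ▷ N) ≫ K ◁ (b ≫ q ▷ N) = b ≫ (D ≫ (p ⊗ₘ q)) ▷ N ≫ (α_ K L N).hom := by
  simp only [MonoidalCategory.whiskerLeft_comp, Category.assoc]
  rw [← whisker_exchange_assoc, reassoc_of% h]
  simp [MonoidalCategory.tensorHom_def]

theorem comp_comm_aux {H A X Y : C} {a : X ⟶ A ⊗ X} {b : Y ⟶ A ⊗ Y} {c : X ⟶ H ⊗ X}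
    {d : Y ⟶ H ⊗ Y} {g : X ⟶ Y} (h1 : a ≫ A ◁ g = g ≫ b) (h2 : c ≫ H ◁ g = g ≫ d) :
    (c ≫ H ◁ a ≫ (α_ H A X).inv) ≫ (H ⊗ A) ◁ g = g ≫ d ≫ H ◁ b ≫ (α_ H A Y).inv := by
  rw [← reassoc_of% h2, ← MonoidalCategory.whiskerLeft_comp_assoc, ← h1]
  simp

section Raw

variable {H A : C} {D : H ⟶ H ⊗ H} {d : A ⟶ A ⊗ A} {t : H ⊗ A ⟶ A ⊗ H} {e : H ⟶ 𝟙_ C}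
  {f : A ⟶ 𝟙_ C}

theorem raw_left_right (hD : D ≫ e ▷ H = (λ_ H).inv) (hd : d ≫ A ◁ f = (ρ_ A).inv) :
    ((D ⊗ₘ d) ≫ middle H t A) ≫ ((e ▷ A ≫ (λ_ A).hom) ⊗ₘ (H ◁ f ≫ (ρ_ H).hom)) = t := by
  calc _ = D ▷ A ⊗≫ (H ⊗ H) ◁ d ⊗≫ H ◁ t ▷ A ⊗≫ (e ▷ (A ⊗ H ⊗ A) ≫ 𝟙_ C ◁ A ◁ H ◁ f) ⊗≫
        𝟙 (A ⊗ H) := by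
        rw [middle, MonoidalCategory.tensorHom_def, MonoidalCategory.tensorHom_def]; monoidal
    _ = D ▷ A ⊗≫ (H ⊗ H) ◁ d ⊗≫ H ◁ (t ▷ A ≫ (A ⊗ H) ◁ f) ⊗≫ e ▷ (A ⊗ H) ⊗≫ 𝟙 _ := by
        rw [← whisker_exchange]; monoidal
    _ = D ▷ A ⊗≫ (H ⊗ H) ◁ (d ≫ A ◁ f) ⊗≫ (H ◁ t ≫ e ▷ (A ⊗ H)) ⊗≫ 𝟙 _ := by
        rw [← whisker_exchange]; monoidal
    _ = (D ≫ e ▷ H) ▷ A ⊗≫ t ⊗≫ 𝟙 _ := by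
        rw [whisker_exchange, hd]; monoidal
    _ = _ := by rw [hD]; monoidal

theorem raw_right_left (hD : D ≫ H ◁ e = (ρ_ H).inv) (hd : d ≫ f ▷ A = (λ_ A).inv)
    (ht : t ≫ A ◁ e ≫ (ρ_ A).hom = e ▷ A ≫ (λ_ A).hom) :
    ((D ⊗ₘ d) ≫ middle H t A) ≫ ((H ◁ f ≫ (ρ_ H).hom) ⊗ₘ (e ▷ A ≫ (λ_ A).hom)) =
      𝟙 (H ⊗ A) := by
  calc _ = D ▷ A ⊗≫ (H ⊗ H) ◁ d ⊗≫ H ◁ (t ≫ A ◁ e ≫ (ρ_ A).hom) ▷ A ⊗≫ H ◁ f ▷ A ⊗≫ 𝟙 _ := by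
        rw [middle, MonoidalCategory.tensorHom_def, MonoidalCategory.tensorHom_def']; monoidal
    _ = D ▷ A ⊗≫ H ◁ (H ◁ d ≫ e ▷ (A ⊗ A)) ⊗≫ H ◁ f ▷ A ⊗≫ 𝟙 _ := by
        rw [ht]; monoidal
    _ = (D ≫ H ◁ e) ▷ A ⊗≫ H ◁ (d ≫ f ▷ A) ⊗≫ 𝟙 _ := by
        rw [whisker_exchange]; monoidal
    _ = _ := by rw [hD, hd]; monoidal

theorem raw_left_left (hD : D ≫ e ▷ H = (λ_ H).inv)
    (ht : t ≫ A ◁ e ≫ (ρ_ A).hom = e ▷ A ≫ (λ_ A).hom) :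
    ((D ⊗ₘ d) ≫ middle H t A) ≫ ((e ▷ A ≫ (λ_ A).hom) ⊗ₘ (e ▷ A ≫ (λ_ A).hom)) =
      (e ▷ A ≫ (λ_ A).hom) ≫ d := by
  have he : H ◁ e ≫ (ρ_ H).hom ≫ e = e ▷ H ≫ (λ_ H).hom ≫ e := by
    rw [← leftUnitor_naturality, ← whisker_exchange_assoc, ← rightUnitor_naturality, unitors_equal]
  calc _ = D ▷ A ⊗≫ (H ⊗ H) ◁ d ⊗≫ H ◁ (t ≫ A ◁ e ≫ (ρ_ A).hom) ▷ A ⊗≫ e ▷ (A ⊗ A) ⊗≫ 𝟙 _ := by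
        rw [middle, MonoidalCategory.tensorHom_def, MonoidalCategory.tensorHom_def']; monoidal
    _ = D ▷ A ≫ ((H ⊗ H) ◁ d ≫ (H ◁ e ≫ (ρ_ H).hom ≫ e) ▷ (A ⊗ A)) ⊗≫ 𝟙 _ := by
        rw [ht]; monoidal
    _ = (D ≫ e ▷ H ≫ (λ_ H).hom ≫ e) ▷ A ≫ 𝟙_ C ◁ d ⊗≫ 𝟙 _ := by
        rw [whisker_exchange, he]; monoidal
    _ = _ := by rw [reassoc_of% hD]; monoidal

theorem raw_right_right (hd : d ≫ A ◁ f = (ρ_ A).inv)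
    (ht : t ≫ f ▷ H ≫ (λ_ H).hom = H ◁ f ≫ (ρ_ H).hom) :
    ((D ⊗ₘ d) ≫ middle H t A) ≫ ((H ◁ f ≫ (ρ_ H).hom) ⊗ₘ (H ◁ f ≫ (ρ_ H).hom)) =
      (H ◁ f ≫ (ρ_ H).hom) ≫ D := by
  calc _ = D ▷ A ⊗≫ (H ⊗ H) ◁ d ⊗≫ H ◁ (t ≫ f ▷ H ≫ (λ_ H).hom) ▷ A ⊗≫ (H ⊗ H) ◁ f ⊗≫ 𝟙 _ := by
        rw [middle, MonoidalCategory.tensorHom_def, MonoidalCategory.tensorHom_def]; monoidal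
    _ = D ▷ A ⊗≫ (H ⊗ H) ◁ d ⊗≫ (H ⊗ H) ◁ (f ▷ A ≫ 𝟙_ C ◁ f) ⊗≫ 𝟙 _ := by
        rw [ht]; monoidal
    _ = D ▷ A ⊗≫ (H ⊗ H) ◁ (d ≫ A ◁ f) ⊗≫ (H ⊗ H) ◁ f ⊗≫ 𝟙 _ := by
        rw [← whisker_exchange]; monoidal
    _ = (D ▷ A ≫ (H ⊗ H) ◁ f) ⊗≫ 𝟙 _ := by rw [hd]; monoidal
    _ = _ := by rw [← whisker_exchange]; monoidal

end Raw

variable [SymmetricCategory C] {A : C} [BimonObj A] [BraidingCoelement A]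
variable (H : Comod A) [BimonObj H]

/-- The comparison functor `((B, α), χ) ↦ (B, (1_H ⊗ α) ∘ χ)`, the identity on morphisms. -/
def toSemidirect : Comod H ⥤ Comod (semidirect H) where
  obj B :=
    { X := B.X.X
      coact := B.coact.f ≫ H.X ◁ B.X.coact ≫ (α_ H.X A B.X.X).inv
      counit_coact := compCoact_counit B
      coact_coact := compCoact_coassoc B }
  map {B B'} g :=
    { f := g.f.f
      comm := by
        have h1 : B.X.coact ≫ A ◁ g.f.f = g.f.f ≫ B'.X.coact := g.f.comm
        have h2 : (B.coact.f : B.X.X ⟶ H.X ⊗ B.X.X) ≫ H.X ◁ g.f.f = g.f.f ≫ B'.coact.f :=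
          congrArg Hom.f g.comm
        change (B.coact.f ≫ H.X ◁ B.X.coact ≫ (α_ H.X A B.X.X).inv) ≫ (H.X ⊗ A) ◁ g.f.f =
          g.f.f ≫ B'.coact.f ≫ H.X ◁ B'.X.coact ≫ (α_ H.X A B'.X.X).inv
        exact comp_comm_aux h1 h2 }

variable {H}

/-- The coaction `N ⟶ (H ⊗ A) ⊗ N` of an `H ⋊ A`-comodule, with `H ⋊ A` written as `H ⊗ A`. -/
def semiCoact (N : Comod (semidirect H)) : N.X ⟶ (H.X ⊗ A) ⊗ N.X := N.coact

/-- The `A`-coaction `λ ∘ (ε_H ⊗ 1_A ⊗ 1_N) ∘ β` on an `H ⋊ A`-comodule `(N, β)`. -/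
def baseCoact (N : Comod (semidirect H)) : N.X ⟶ A ⊗ N.X :=
  semiCoact N ≫ (α_ H.X A N.X).hom ≫ counitV H ▷ (A ⊗ N.X) ≫ (λ_ (A ⊗ N.X)).hom

/-- The `H`-coaction `(1_H ⊗ λ) ∘ (1_H ⊗ ε_A ⊗ 1_N) ∘ β` on an `H ⋊ A`-comodule `(N, β)`. -/
def fibreCoact (N : Comod (semidirect H)) : N.X ⟶ H.X ⊗ N.X :=
  semiCoact N ≫ (α_ H.X A N.X).hom ≫ H.X ◁ ε[A] ▷ N.X ≫ H.X ◁ (λ_ N.X).hom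

theorem semiCoact_coassoc (N : Comod (semidirect H)) :
    semiCoact N ≫ (H.X ⊗ A) ◁ semiCoact N = semiCoact N ≫ semiComul H ▷ N.X ≫
      (α_ (H.X ⊗ A) (H.X ⊗ A) N.X).hom := N.coact_coact

theorem semiCoact_counit (N : Comod (semidirect H)) :
    semiCoact N ≫ semiCounit H ▷ N.X = (λ_ N.X).inv := N.counit_coact

theorem baseCoact_eq (N : Comod (semidirect H)) :
    baseCoact N = semiCoact N ≫ (counitV H ▷ A ≫ (λ_ A).hom) ▷ N.X := by
  simp [baseCoact]

theorem fibreCoact_eq (N : Comod (semidirect H)) :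
    fibreCoact N = semiCoact N ≫ (H.X ◁ ε[A] ≫ (ρ_ H.X).hom) ▷ N.X := by
  simp [fibreCoact]

theorem tau_counit_right : tau H ≫ A ◁ counitV H ≫ (ρ_ A).hom = counitV H ▷ A ≫ (λ_ A).hom := by
  have h := tau_counit (H := H)
  rw [reassoc_of% h, ← braiding_naturality_left_assoc, braiding_tensorUnit_left]
  simp

theorem tau_counit_left : tau H ≫ ε[A] ▷ H.X ≫ (λ_ H.X).hom = H.X ◁ ε[A] ≫ (ρ_ H.X).hom := by
  have h1 := Bimon.mul_counit A
  have h2 := H.counit_coact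
  have h3 : (β_ H.X A).hom ≫ ε[A] ▷ H.X = H.X ◁ ε[A] ≫ (ρ_ H.X).hom ≫ (λ_ H.X).inv := by
    rw [← braiding_naturality_right, braiding_tensorUnit_right]
  calc tau H ≫ ε[A] ▷ H.X ≫ (λ_ H.X).hom = H.coact ▷ A ⊗≫ A ◁ (β_ H.X A).hom ⊗≫
        (μ[A] ≫ ε[A]) ▷ H.X ≫ (λ_ H.X).hom := by
        rw [tau]; monoidal
    _ = H.coact ▷ A ⊗≫ A ◁ ((β_ H.X A).hom ≫ ε[A] ▷ H.X) ⊗≫ ε[A] ▷ H.X ≫ (λ_ H.X).hom := by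
        rw [h1, MonoidalCategory.tensorHom_def']; monoidal
    _ = (H.coact ▷ A ≫ (A ⊗ H.X) ◁ ε[A]) ⊗≫ ε[A] ▷ H.X ≫ (λ_ H.X).hom := by
        rw [h3]; monoidal
    _ = H.X ◁ ε[A] ⊗≫ (H.coact ≫ ε[A] ▷ H.X) ≫ (λ_ H.X).hom := by
        rw [← whisker_exchange]; monoidal
    _ = _ := by rw [h2]; monoidal

theorem baseCoact_coassoc (N : Comod (semidirect H)) :
    baseCoact N ≫ A ◁ baseCoact N = baseCoact N ≫ Δ[A] ▷ N.X ≫ (α_ A A N.X).hom := by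
  have h : semiComul H ≫ ((counitV H ▷ A ≫ (λ_ A).hom) ⊗ₘ (counitV H ▷ A ≫ (λ_ A).hom)) =
      (counitV H ▷ A ≫ (λ_ A).hom) ≫ Δ[A] :=
    raw_left_left (congrArg Hom.f (ComonObj.counit_comul H)) tau_counit_right
  rw [baseCoact_eq, coact_mixed (semiCoact_coassoc N), h]
  simp

theorem baseCoact_counit (N : Comod (semidirect H)) :
    baseCoact N ≫ ε[A] ▷ N.X = (λ_ N.X).inv := by
  rw [baseCoact_eq, Category.assoc, ← comp_whiskerRight, ← semiCounit_eq, semiCoact_counit]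

theorem fibreCoact_coassoc (N : Comod (semidirect H)) :
    fibreCoact N ≫ H.X ◁ fibreCoact N = fibreCoact N ≫ comulV H ▷ N.X ≫ (α_ H.X H.X N.X).hom := by
  have h : semiComul H ≫ ((H.X ◁ ε[A] ≫ (ρ_ H.X).hom) ⊗ₘ (H.X ◁ ε[A] ≫ (ρ_ H.X).hom)) =
      (H.X ◁ ε[A] ≫ (ρ_ H.X).hom) ≫ comulV H :=
    raw_right_right (ComonObj.comul_counit A) tau_counit_left
  rw [fibreCoact_eq, coact_mixed (semiCoact_coassoc N), h]
  simp

theorem fibreCoact_counit (N : Comod (semidirect H)) :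
    fibreCoact N ≫ counitV H ▷ N.X = (λ_ N.X).inv := by
  have h : (H.X ◁ ε[A] ≫ (ρ_ H.X).hom) ≫ counitV H = semiCounit H := by
    rw [semiCounit, MonoidalCategory.tensorHom_def', Category.assoc, unitors_equal, Category.assoc,
      rightUnitor_naturality]
  rw [fibreCoact_eq, Category.assoc, ← comp_whiskerRight, h, semiCoact_counit]

theorem fibre_base (N : Comod (semidirect H)) :
    fibreCoact N ≫ H.X ◁ baseCoact N ≫ (α_ H.X A N.X).inv = semiCoact N := by
  have h : semiComul H ≫ ((H.X ◁ ε[A] ≫ (ρ_ H.X).hom) ⊗ₘ (counitV H ▷ A ≫ (λ_ A).hom)) =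
      𝟙 (H.X ⊗ A) :=
    raw_right_left (congrArg Hom.f (ComonObj.comul_counit H)) (ComonObj.counit_comul A)
      tau_counit_right
  have h2 := coact_mixed (semiCoact_coassoc N) (H.X ◁ ε[A] ≫ (ρ_ H.X).hom)
    (counitV H ▷ A ≫ (λ_ A).hom)
  rw [fibreCoact_eq, baseCoact_eq, ← Category.assoc, h2, h]
  simp

theorem base_fibre (N : Comod (semidirect H)) :
    baseCoact N ≫ A ◁ fibreCoact N = semiCoact N ≫ tau H ▷ N.X ≫ (α_ A H.X N.X).hom := by
  have h : semiComul H ≫ ((counitV H ▷ A ≫ (λ_ A).hom) ⊗ₘ (H.X ◁ ε[A] ≫ (ρ_ H.X).hom)) = tau H :=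
    raw_left_right (congrArg Hom.f (ComonObj.counit_comul H)) (ComonObj.comul_counit A)
  rw [fibreCoact_eq, baseCoact_eq, coact_mixed (semiCoact_coassoc N), h]

/-- An `H ⋊ A`-comodule as an `A`-comodule. -/
def baseComod (N : Comod (semidirect H)) : Comod A where
  X := N.X
  coact := baseCoact N
  counit_coact := baseCoact_counit N
  coact_coact := baseCoact_coassoc N

/-- The `H`-coaction on an `H ⋊ A`-comodule, as a morphism of `A`-comodules. -/
def fibreHom (N : Comod (semidirect H)) : baseComod N ⟶ H ⊗ baseComod N where
  f := fibreCoact N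
  comm := by
    rw [tensor_coact_tau]
    have h1 := fibre_base N
    have h2 := base_fibre N
    rw [← h1] at h2
    simp only [Category.assoc] at h2
    exact h2

variable (H) in
/-- The functor `(N, β) ↦ ((N, baseCoact), fibreCoact)`, the identity on morphisms. -/
def ofSemidirect : Comod (semidirect H) ⥤ Comod H where
  obj N :=
    { X := baseComod N
      coact := fibreHom N
      counit_coact := hom_ext (fibreCoact_counit N)
      coact_coact := hom_ext (fibreCoact_coassoc N) }
  map {N N'} g :=
    { f :=
        { f := g.f
          comm := by
            have h : semiCoact N ≫ (H.X ⊗ A) ◁ g.f = g.f ≫ semiCoact N' := g.comm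
            change baseCoact N ≫ A ◁ g.f = g.f ≫ baseCoact N'
            rw [baseCoact_eq, baseCoact_eq, Category.assoc, ← whisker_exchange, reassoc_of% h] }
      comm := hom_ext (by
        have h : semiCoact N ≫ (H.X ⊗ A) ◁ g.f = g.f ≫ semiCoact N' := g.comm
        change fibreCoact N ≫ H.X ◁ g.f = g.f ≫ fibreCoact N'
        rw [fibreCoact_eq, fibreCoact_eq, Category.assoc, ← whisker_exchange, reassoc_of% h]) }

end Comparison

end Comod

/-- A functor between monoidal categories is strict monoidal if it admits a monoidal structure
whose structure morphisms `𝟙 ⟶ F 𝟙` and `F X ⊗ F Y ⟶ F (X ⊗ Y)` are identities; that is, domain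
and codomain are equal and the morphism is the identity under this equality. -/
def IsStrictMonoidal {C : Type*} [Category* C] [MonoidalCategory C] {D : Type*} [Category* D]
    [MonoidalCategory D] (F : C ⥤ D) : Prop :=
  ∃ _ : F.Monoidal,
    (∃ h : 𝟙_ D = F.obj (𝟙_ C), Functor.LaxMonoidal.ε F = eqToHom h) ∧
    ∀ X Y : C, ∃ h : F.obj X ⊗ F.obj Y = F.obj (X ⊗ Y), Functor.LaxMonoidal.μ F X Y = eqToHom h

end

namespace Comod

/-! A coaction `β` of `H ⋊ A` carries the same information as an `A`-coaction `α` together with an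
`A`-colinear `H`-coaction `χ`. Applying `ε_H` or `ε_A` to `β` produces the two parts.
Coassociativity of `β`, followed by the counits on the two inner factors `A` and `H` of the
comultiplied `H ⊗ A`, reassembles `β` as `(1 ⊗ α) ∘ χ`; this is `fibre_base`. In the other direction
the counit laws of `χ` and `α` strip `(1 ⊗ α) ∘ χ` back to `α` and `χ` (`comp_counit_left`,
`comp_counit_right`). Both functors leave underlying objects and morphisms alone, so being mutually
inverse is a matter of equal coactions.

The substance lies in the tensor product. The `H`-coaction on `B ⊗ B'` is formed in `𝒲` and moves
`H` past `B` by the `γ`-twisted braiding. The `H ⋊ A`-coaction on `B ⊗ B'` is formed in `𝒱` and uses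
only the symmetry; there the twist sits inside the multiplication of `H ⋊ A`, through `s_{A,H}`. The
two agree by `braid_coact`: the coaction `E ⟶ A ⊗ E`, with the right-hand `E` given the trivial
coaction, is colinear, and a trivial comodule braids by the symmetry. Naturality and the hexagon
then trade the twisted braiding of `E` with `H` for the symmetry past `E` followed by `s_{A,H}` past
`A`. `tensorHom_middle_tensorμ` pushes this exchange through the whole coaction, and
`compCoact_tensor` is its application.

Tensor products and units are therefore preserved as equalities of objects. For the inverse functor
this follows formally from the bijection on objects. The structure morphisms lie over identities of
`𝒱`, so every coherence law reduces to one between identities. -/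

/-! ### Identities in the base category for composite coactions. -/

/-- The hypothesis lets the coaction `a` pass the crossing `s` of `E` with `H`, at the price of
replacing `s` by a symmetry and a crossing `t` of `A` with `H`. The rest is interchange and the
hexagon for the symmetry. It extends `mul_coact_aux` from one object `E` to a pair `E`, `E'` with
separate coactions, as needed for a tensor product of two comodules. -/
theorem middle_whisker_tensorμ {C : Type u} [Category.{v} C] [MonoidalCategory C]
    [SymmetricCategory C] {H A E E' : C} {a : E ⟶ A ⊗ E} {b : E' ⟶ A ⊗ E'} {s : E ⊗ H ⟶ H ⊗ E}
    {t : A ⊗ H ⟶ H ⊗ A}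
    (h : s ≫ H ◁ a = a ▷ H ≫ (α_ A E H).hom ≫ A ◁ (β_ E H).hom ≫ (α_ A H E).inv ≫
      t ▷ E ≫ (α_ H A E).hom) :
    middle H s E' ≫ (H ⊗ H) ◁ ((a ⊗ₘ b) ≫ tensorμ A E A E') =
      ((H ◁ a ≫ (α_ H A E).inv) ⊗ₘ (H ◁ b ≫ (α_ H A E').inv)) ≫
        tensorμ (H ⊗ A) E (H ⊗ A) E' ≫ middle H t A ▷ (E ⊗ E') ≫
          (α_ (H ⊗ H) (A ⊗ A) (E ⊗ E')).hom := by
  calc _ = 𝟙 _ ⊗≫ H ◁ (s ≫ H ◁ a) ▷ E' ⊗≫ (H ⊗ H ⊗ A ⊗ E) ◁ b ⊗≫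
        (H ⊗ H ⊗ A) ◁ (β_ E A).hom ▷ E' ⊗≫ 𝟙 _ := by
        rw [middle, MonoidalCategory.tensorHom_def, tensorμ]; monoidal
    _ = 𝟙 _ ⊗≫ H ◁ a ▷ (H ⊗ E') ⊗≫ (H ⊗ A) ◁ (β_ E H).hom ▷ E' ⊗≫
        H ◁ (t ▷ (E ⊗ E') ≫ (H ⊗ A) ◁ (E ◁ b ≫ (α_ E A E').inv ≫ (β_ E A).hom ▷ E')) ⊗≫
          𝟙 _ := by
        -- The twisted crossing `s` disappears here; what remains is to postpone `t` and advance
        -- `b`.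
        rw [h]; monoidal
    _ = 𝟙 _ ⊗≫ H ◁ a ▷ (H ⊗ E') ⊗≫ (H ⊗ A) ◁ ((β_ E H).hom ▷ E' ≫ (H ⊗ E) ◁ b) ⊗≫
        (H ⊗ A ⊗ H) ◁ (β_ E A).hom ▷ E' ⊗≫ H ◁ t ▷ (A ⊗ E ⊗ E') ⊗≫ 𝟙 _ := by
        rw [← whisker_exchange]; monoidal
    _ = 𝟙 _ ⊗≫ H ◁ a ▷ (H ⊗ E') ⊗≫ (H ⊗ A) ◁ ((E ⊗ H) ◁ b ≫ (β_ E H).hom ▷ (A ⊗ E')) ⊗≫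
        (H ⊗ A ⊗ H) ◁ (β_ E A).hom ▷ E' ⊗≫ H ◁ t ▷ (A ⊗ E ⊗ E') ⊗≫ 𝟙 _ := by
        rw [← whisker_exchange]
    _ = _ := by
        -- The hexagon fuses the crossings of `E` with `H` and then with `A` into the single
        -- crossing of `E` with `H ⊗ A` that `tensorμ` contains.
        rw [middle, MonoidalCategory.tensorHom_def, tensorμ, braiding_tensor_right_hom]; monoidal

/-- With `c`, `d` the `H`-coactions, `a`, `b` the `A`-coactions and `m`, `k` the multiplications,
the left side is the composite of the two coactions of a tensor product formed in `𝒲`, and the right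
side is the tensor product in `𝒱` of the two composite coactions. The multiplication `m` meets only
the `H` factors, so it slides past `a` and `b` and leaves exactly the preceding identity. -/
theorem tensorHom_middle_tensorμ {C : Type u} [Category.{v} C] [MonoidalCategory C]
    [SymmetricCategory C] {H A E E' : C} {a : E ⟶ A ⊗ E} {b : E' ⟶ A ⊗ E'} {s : E ⊗ H ⟶ H ⊗ E}
    {t : A ⊗ H ⟶ H ⊗ A}
    (h : s ≫ H ◁ a = a ▷ H ≫ (α_ A E H).hom ≫ A ◁ (β_ E H).hom ≫ (α_ A H E).inv ≫
      t ▷ E ≫ (α_ H A E).hom) (c : E ⟶ H ⊗ E) (d : E' ⟶ H ⊗ E') (m : H ⊗ H ⟶ H)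
    (k : A ⊗ A ⟶ A) :
    ((c ⊗ₘ d) ≫ middle H s E' ≫ m ▷ (E ⊗ E')) ≫
        H ◁ ((a ⊗ₘ b) ≫ tensorμ A E A E' ≫ k ▷ (E ⊗ E')) ≫ (α_ H A (E ⊗ E')).inv =
      ((c ≫ H ◁ a ≫ (α_ H A E).inv) ⊗ₘ (d ≫ H ◁ b ≫ (α_ H A E').inv)) ≫
        tensorμ (H ⊗ A) E (H ⊗ A) E' ≫ (middle H t A ≫ (m ⊗ₘ k)) ▷ (E ⊗ E') := by
  have h' := middle_whisker_tensorμ (b := b) h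
  calc _ = (c ⊗ₘ d) ≫ (middle H s E' ≫ (H ⊗ H) ◁ ((a ⊗ₘ b) ≫ tensorμ A E A E')) ≫
        m ▷ ((A ⊗ A) ⊗ (E ⊗ E')) ≫ H ◁ k ▷ (E ⊗ E') ≫ (α_ H A (E ⊗ E')).inv := by
        simp only [Category.assoc, MonoidalCategory.whiskerLeft_comp]
        -- Two interchanges: `m` passes first `tensorμ`, then `a ⊗ b`.
        rw [whisker_exchange_assoc, whisker_exchange_assoc]
    _ = _ := by
        rw [h', MonoidalCategory.tensorHom_def m k, ← tensorHom_comp_tensorHom]; simp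

/-- The counit on `H` slides in front of `a`, where the counit law of `c` removes it. This recovers
the `A`-coaction from a composite; its companion below recovers the `H`-coaction in the same way. -/
theorem comp_counit_left {C : Type u} [Category.{v} C] [MonoidalCategory C] {H A X : C}
    {c : X ⟶ H ⊗ X} {e : H ⟶ 𝟙_ C} (h : c ≫ e ▷ X = (λ_ X).inv) (a : X ⟶ A ⊗ X) :
    (c ≫ H ◁ a ≫ (α_ H A X).inv) ≫ (α_ H A X).hom ≫ e ▷ (A ⊗ X) ≫ (λ_ (A ⊗ X)).hom = a := by
  simp only [Category.assoc, Iso.inv_hom_id_assoc]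
  rw [whisker_exchange_assoc, reassoc_of% h]
  simp

theorem comp_counit_right {C : Type u} [Category.{v} C] [MonoidalCategory C] {H A X : C}
    {a : X ⟶ A ⊗ X} {e : A ⟶ 𝟙_ C} (h : a ≫ e ▷ X = (λ_ X).inv) (c : X ⟶ H ⊗ X) :
    (c ≫ H ◁ a ≫ (α_ H A X).inv) ≫ (α_ H A X).hom ≫ H ◁ e ▷ X ≫ H ◁ (λ_ X).hom = c := by
  simp only [Category.assoc, Iso.inv_hom_id_assoc]
  rw [← MonoidalCategory.whiskerLeft_comp_assoc, h, ← MonoidalCategory.whiskerLeft_comp]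
  simp

theorem one_comp_one {C : Type u} [Category.{v} C] [MonoidalCategory C] {H A : C}
    (i : 𝟙_ C ⟶ H) (j : 𝟙_ C ⟶ A) :
    ((λ_ (𝟙_ C)).inv ≫ i ▷ 𝟙_ C) ≫ H ◁ ((λ_ (𝟙_ C)).inv ≫ j ▷ 𝟙_ C) ≫ (α_ H A (𝟙_ C)).inv =
      (λ_ (𝟙_ C)).inv ≫ ((λ_ (𝟙_ C)).inv ≫ (i ⊗ₘ j)) ▷ 𝟙_ C := by
  rw [MonoidalCategory.tensorHom_def]
  monoidal

/-! ### Coherence laws with identity structure morphisms. -/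

/-- This law and the two unit laws below are stated in the base category, so that they serve both
functors: on underlying objects and morphisms each functor is the identity. -/
theorem assoc_of_id {C : Type u} [Category.{v} C] [MonoidalCategory C] (X Y Z : C) :
    𝟙 (X ⊗ Y) ▷ Z ≫ 𝟙 ((X ⊗ Y) ⊗ Z) ≫ (α_ X Y Z).hom =
      (α_ X Y Z).hom ≫ X ◁ 𝟙 (Y ⊗ Z) ≫ 𝟙 (X ⊗ Y ⊗ Z) := by
  simp

theorem left_unit_of_id {C : Type u} [Category.{v} C] [MonoidalCategory C] (X : C) :
    (λ_ X).hom = 𝟙 (𝟙_ C) ▷ X ≫ 𝟙 (𝟙_ C ⊗ X) ≫ (λ_ X).hom := by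
  simp

theorem right_unit_of_id {C : Type u} [Category.{v} C] [MonoidalCategory C] (X : C) :
    (ρ_ X).hom = X ◁ 𝟙 (𝟙_ C) ≫ 𝟙 (X ⊗ 𝟙_ C) ≫ (ρ_ X).hom := by
  simp

/-! ### Equality of comodules and transport along it. -/

theorem mk_congr {C : Type u} [Category.{v} C] [MonoidalCategory C] {A : C} [ComonObj A] {X : C}
    {c d : X ⟶ A ⊗ X} (h : c = d) {p p' q q'} :
    (⟨X, c, p, q⟩ : Comod A) = ⟨X, d, p', q'⟩ := by
  subst h; rfl

/-- When `M.X` and `N.X` agree definitionally, as in every use below, the right side is an identity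
morphism by proof irrelevance. Transport along an equality of comodules is then invisible in the
base category. -/
theorem eqToHom_f {C : Type u} [Category.{v} C] [MonoidalCategory C] {A : C} [ComonObj A]
    {M N : Comod A} (h : M = N) : (eqToHom h).f = eqToHom (congrArg Comod.X h) := by
  subst h; rfl

variable {C : Type u} [Category.{v} C] [MonoidalCategory C] [SymmetricCategory C]
  {A : C} [BimonObj A] [BraidingCoelement A] {H : Comod A} [BimonObj H]

/-- An `H`-comodule in `𝒲` is determined by two coactions in `𝒱`. Comparing `c` with `d` through
their underlying morphisms avoids a heterogeneous equality, since as morphisms of `A`-comodules they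
have a common type only once `a` and `b` are identified. -/
theorem mk_mk_congr {X : C} {a b : X ⟶ A ⊗ X} (h : a = b) {p p' q q'}
    {c : (⟨X, a, p, q⟩ : Comod A) ⟶ H ⊗ ⟨X, a, p, q⟩}
    {d : (⟨X, b, p', q'⟩ : Comod A) ⟶ H ⊗ ⟨X, b, p', q'⟩} (h' : c.f = d.f) {r r' s s'} :
    (⟨⟨X, a, p, q⟩, c, r, s⟩ : Comod H) = ⟨⟨X, b, p', q'⟩, d, r', s'⟩ := by
  subst h
  obtain rfl : c = d := hom_ext h'
  rfl

theorem eqToHom_f_f {M N : Comod H} (h : M = N) :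
    (eqToHom h).f.f = eqToHom (congrArg (fun M : Comod H => M.X.X) h) := by
  subst h; rfl

/-! ### The comparison on objects. -/

/-- Here `s` is the braiding in `𝒲` of `B.X` with `H` and `t` is that of the regular comodule `A`
with `H`. Their compatibility is `braid_coact`, and unfolding the tensor products in `Comod H` and
`Comod A` gives the required shape definitionally. -/
theorem compCoact_tensor (B B' : Comod H) : compCoact (B ⊗ B') =
    (compCoact B ⊗ₘ compCoact B') ≫ tensorμ (H.X ⊗ A) B.X.X (H.X ⊗ A) B'.X.X ≫
      semiMul H ▷ (B.X.X ⊗ B'.X.X) :=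
  tensorHom_middle_tensorμ (braid_coact (H := H) B.X) B.coact.f B'.coact.f (mulV H) μ[A]

/-- The unit comodule has `H`-coaction `η_H` and `A`-coaction `η_A`, which compose to `η_H ⊗ η_A`,
the unit of `H ⋊ A`. -/
theorem compCoact_unit : compCoact (𝟙_ (Comod H)) = (λ_ (𝟙_ C)).inv ≫ semiOne H ▷ 𝟙_ C :=
  one_comp_one (unitV H) η[A]

theorem toSemidirect_obj_tensor (B B' : Comod H) :
    (toSemidirect H).obj B ⊗ (toSemidirect H).obj B' = (toSemidirect H).obj (B ⊗ B') :=
  mk_congr (A := semidirect H) (compCoact_tensor B B').symm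

variable (H) in
theorem toSemidirect_obj_unit :
    𝟙_ (Comod (semidirect H)) = (toSemidirect H).obj (𝟙_ (Comod H)) :=
  mk_congr (A := semidirect H) compCoact_unit.symm

theorem baseCoact_toSemidirect (B : Comod H) :
    baseCoact ((toSemidirect H).obj B) = B.X.coact :=
  comp_counit_left (coact_f_counit B) B.X.coact

theorem fibreCoact_toSemidirect (B : Comod H) :
    fibreCoact ((toSemidirect H).obj B) = B.coact.f :=
  comp_counit_right B.X.counit_coact B.coact.f

theorem ofSemidirect_toSemidirect_obj (B : Comod H) :
    (ofSemidirect H).obj ((toSemidirect H).obj B) = B :=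
  mk_mk_congr (baseCoact_toSemidirect B) (fibreCoact_toSemidirect B)

/-- The underlying object is unchanged, so only the reconstruction of the coaction from its two
parts matters. -/
theorem toSemidirect_ofSemidirect_obj (N : Comod (semidirect H)) :
    (toSemidirect H).obj ((ofSemidirect H).obj N) = N :=
  mk_congr (A := semidirect H) (fibre_base N)

/-- A formal consequence of bijectivity on objects: an inverse of a map preserving tensor products
preserves them too, so no further computation with coactions is needed. -/
theorem ofSemidirect_obj_tensor (N N' : Comod (semidirect H)) :
    (ofSemidirect H).obj N ⊗ (ofSemidirect H).obj N' = (ofSemidirect H).obj (N ⊗ N') := by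
  rw [← ofSemidirect_toSemidirect_obj ((ofSemidirect H).obj N ⊗ (ofSemidirect H).obj N'),
    ← toSemidirect_obj_tensor, toSemidirect_ofSemidirect_obj, toSemidirect_ofSemidirect_obj]

variable (H) in
theorem ofSemidirect_obj_unit :
    𝟙_ (Comod H) = (ofSemidirect H).obj (𝟙_ (Comod (semidirect H))) := by
  rw [toSemidirect_obj_unit, ofSemidirect_toSemidirect_obj]

/-! ### The two functors are mutually inverse. -/

-- On morphisms both composites keep the underlying map, so after forgetting both comodule
-- structures the transports become identities and nothing is left to compute.
variable (H) in
theorem toSemidirect_comp_ofSemidirect : toSemidirect H ⋙ ofSemidirect H = 𝟭 (Comod H) :=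
  CategoryTheory.Functor.ext ofSemidirect_toSemidirect_obj fun X Y g => hom_ext (hom_ext (by
    have h1 := eqToHom_f_f (ofSemidirect_toSemidirect_obj X)
    have h2 := eqToHom_f_f (ofSemidirect_toSemidirect_obj Y).symm
    change g.f.f = (eqToHom (ofSemidirect_toSemidirect_obj X)).f.f ≫ g.f.f ≫
      (eqToHom (ofSemidirect_toSemidirect_obj Y).symm).f.f
    rw [h1, h2]
    exact ((Category.id_comp _).trans (Category.comp_id _)).symm))

variable (H) in
theorem ofSemidirect_comp_toSemidirect :
    ofSemidirect H ⋙ toSemidirect H = 𝟭 (Comod (semidirect H)) :=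
  CategoryTheory.Functor.ext toSemidirect_ofSemidirect_obj fun X Y g => hom_ext (by
    have h1 := eqToHom_f (toSemidirect_ofSemidirect_obj X)
    have h2 := eqToHom_f (toSemidirect_ofSemidirect_obj Y).symm
    change g.f = (eqToHom (toSemidirect_ofSemidirect_obj X)).f ≫ g.f ≫
      (eqToHom (toSemidirect_ofSemidirect_obj Y).symm).f
    rw [h1, h2]
    exact ((Category.id_comp _).trans (Category.comp_id _)).symm)

/-! ### Strict monoidality. -/

variable (H) in
theorem isStrictMonoidal_toSemidirect : IsStrictMonoidal (toSemidirect H) := by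
  -- The underlying objects of source and target coincide definitionally, so the transport lies over
  -- an identity.
  have hε : (eqToHom (toSemidirect_obj_unit H)).f = 𝟙 (𝟙_ C) := eqToHom_f _
  have hμ (X Y : Comod H) : (eqToHom (toSemidirect_obj_tensor X Y)).f = 𝟙 (X.X.X ⊗ Y.X.X) :=
    eqToHom_f _
  -- The structure morphisms are chosen to be the transports themselves, so that strictness holds by
  -- `rfl`; the coherence laws can be checked on underlying morphisms because the forgetful functor
  -- is faithful.
  refine ⟨Functor.CoreMonoidal.toMonoidal
    { εIso := eqToIso (toSemidirect_obj_unit H)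
      μIso := fun X Y => eqToIso (toSemidirect_obj_tensor X Y)
      μIso_hom_natural_left := fun {X Y} f Z => hom_ext ?_
      μIso_hom_natural_right := fun {X Y} Z f => hom_ext ?_
      associativity := fun X Y Z => hom_ext ?_
      left_unitality := fun X => hom_ext ?_
      right_unitality := fun X => hom_ext ?_ }, ⟨toSemidirect_obj_unit H, rfl⟩,
    fun X Y => ⟨toSemidirect_obj_tensor X Y, rfl⟩⟩
  · change f.f.f ▷ Z.X.X ≫ (eqToHom (toSemidirect_obj_tensor Y Z)).f =
      (eqToHom (toSemidirect_obj_tensor X Z)).f ≫ f.f.f ▷ Z.X.X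
    rw [hμ, hμ]
    exact (Category.comp_id _).trans (Category.id_comp _).symm
  · change Z.X.X ◁ f.f.f ≫ (eqToHom (toSemidirect_obj_tensor Z Y)).f =
      (eqToHom (toSemidirect_obj_tensor Z X)).f ≫ Z.X.X ◁ f.f.f
    rw [hμ, hμ]
    exact (Category.comp_id _).trans (Category.id_comp _).symm
  -- The associators of both comodule categories are the one of `𝒱` on underlying objects, so the
  -- law restates definitionally as an equation in `𝒱`.
  · change (eqToHom (toSemidirect_obj_tensor X Y)).f ▷ Z.X.X ≫
        (eqToHom (toSemidirect_obj_tensor (X ⊗ Y) Z)).f ≫ (α_ X.X.X Y.X.X Z.X.X).hom =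
      (α_ X.X.X Y.X.X Z.X.X).hom ≫ X.X.X ◁ (eqToHom (toSemidirect_obj_tensor Y Z)).f ≫
        (eqToHom (toSemidirect_obj_tensor X (Y ⊗ Z))).f
    rw [hμ, hμ, hμ, hμ]
    exact assoc_of_id _ _ _
  · change (λ_ X.X.X).hom = (eqToHom (toSemidirect_obj_unit H)).f ▷ X.X.X ≫
      (eqToHom (toSemidirect_obj_tensor (𝟙_ _) X)).f ≫ (λ_ X.X.X).hom
    rw [hε, hμ]
    exact left_unit_of_id _
  · change (ρ_ X.X.X).hom = X.X.X ◁ (eqToHom (toSemidirect_obj_unit H)).f ≫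
      (eqToHom (toSemidirect_obj_tensor X (𝟙_ _))).f ≫ (ρ_ X.X.X).hom
    rw [hε, hμ]
    exact right_unit_of_id _

-- The same reduction to the base category applies, now forgetting two layers of structure: a
-- morphism in `Comod H` is determined by its underlying morphism of `A`-comodules, hence by a
-- morphism of `𝒱`.
variable (H) in
theorem isStrictMonoidal_ofSemidirect : IsStrictMonoidal (ofSemidirect H) := by
  have hε : (eqToHom (ofSemidirect_obj_unit H)).f.f = 𝟙 (𝟙_ C) := eqToHom_f_f _
  have hμ (X Y : Comod (semidirect H)) :
      (eqToHom (ofSemidirect_obj_tensor X Y)).f.f = 𝟙 (X.X ⊗ Y.X) := eqToHom_f_f _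
  refine ⟨Functor.CoreMonoidal.toMonoidal
    { εIso := eqToIso (ofSemidirect_obj_unit H)
      μIso := fun X Y => eqToIso (ofSemidirect_obj_tensor X Y)
      μIso_hom_natural_left := fun {X Y} f Z => hom_ext (hom_ext ?_)
      μIso_hom_natural_right := fun {X Y} Z f => hom_ext (hom_ext ?_)
      associativity := fun X Y Z => hom_ext (hom_ext ?_)
      left_unitality := fun X => hom_ext (hom_ext ?_)
      right_unitality := fun X => hom_ext (hom_ext ?_) }, ⟨ofSemidirect_obj_unit H, rfl⟩,
    fun X Y => ⟨ofSemidirect_obj_tensor X Y, rfl⟩⟩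
  · change f.f ▷ Z.X ≫ (eqToHom (ofSemidirect_obj_tensor Y Z)).f.f =
      (eqToHom (ofSemidirect_obj_tensor X Z)).f.f ≫ f.f ▷ Z.X
    rw [hμ, hμ]
    exact (Category.comp_id _).trans (Category.id_comp _).symm
  · change Z.X ◁ f.f ≫ (eqToHom (ofSemidirect_obj_tensor Z Y)).f.f =
      (eqToHom (ofSemidirect_obj_tensor Z X)).f.f ≫ Z.X ◁ f.f
    rw [hμ, hμ]
    exact (Category.comp_id _).trans (Category.id_comp _).symm
  · change (eqToHom (ofSemidirect_obj_tensor X Y)).f.f ▷ Z.X ≫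
        (eqToHom (ofSemidirect_obj_tensor (X ⊗ Y) Z)).f.f ≫ (α_ X.X Y.X Z.X).hom =
      (α_ X.X Y.X Z.X).hom ≫ X.X ◁ (eqToHom (ofSemidirect_obj_tensor Y Z)).f.f ≫
        (eqToHom (ofSemidirect_obj_tensor X (Y ⊗ Z))).f.f
    rw [hμ, hμ, hμ, hμ]
    exact assoc_of_id _ _ _
  · change (λ_ X.X).hom = (eqToHom (ofSemidirect_obj_unit H)).f.f ▷ X.X ≫
      (eqToHom (ofSemidirect_obj_tensor (𝟙_ _) X)).f.f ≫ (λ_ X.X).hom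
    rw [hε, hμ]
    exact left_unit_of_id _
  · change (ρ_ X.X).hom = X.X ◁ (eqToHom (ofSemidirect_obj_unit H)).f.f ≫
      (eqToHom (ofSemidirect_obj_tensor X (𝟙_ _))).f.f ≫ (ρ_ X.X).hom
    rw [hε, hμ]
    exact right_unit_of_id _

end Comod

theorem mainTheorem2 {C : Type u} [Category.{v} C] [MonoidalCategory C] [SymmetricCategory C]
    (A : C) [BimonObj A] [BraidingCoelement A] (H : Comod A) [BimonObj H] :
    IsStrictMonoidal (Comod.toSemidirect H) ∧ IsStrictMonoidal (Comod.ofSemidirect H) ∧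
      Comod.toSemidirect H ⋙ Comod.ofSemidirect H = 𝟭 (Comod H) ∧
      Comod.ofSemidirect H ⋙ Comod.toSemidirect H = 𝟭 (Comod (Comod.semidirect H)) :=
  ⟨Comod.isStrictMonoidal_toSemidirect H, Comod.isStrictMonoidal_ofSemidirect H,
    Comod.toSemidirect_comp_ofSemidirect H, Comod.ofSemidirect_comp_toSemidirect H⟩
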